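/- All curves are in the complex projective plane $\mathbb{CP}^2$. A pencil of degree $d$ curves without fixed components consists of the curves $aC_1+bC_2=0$, $[a:b]\in\mathbb{CP}^1$ (its fibers), where $C_1,C_2\in\mathbb C[x,y,z]$ are linearly independent forms of degree $d$ without common factor; its base $\mathcal X$ is the finite set $\{C_1=C_2=0\}$. Let $\varphi:S\to\mathbb{CP}^2$ be the blow-up at the points of $\mathcal X$ and let $\tilde\pi:S\to\mathbb{CP}^1$ be the lift to $S$ (its extension by continuity) of the rational map $\pi(p)=[C_2(p):-C_1(p)]$. The pencil is connected if every fiber of $\tilde\pi$ is connected. A form is completely reducible if it is, up to a nonzero constant, a product $\prod_{i=1}^q\alpha_i^{m_i}$ with pairwise nonproportional linear forms $\alpha_i$ and integers $m_i>0$; its exponent is $\gcd(m_1,\dots,m_q)$. A pencil of Ceva type is a connected pencil without fixed components in which at least three fibers are completely reducible. A $(k,d)$-multinet consists of a finite set $\mathcal L$ of lines in $\mathbb{CP}^2$ with multiplicities $m:\mathcal L\to\mathbb Z_{>0}$, a partition of $\mathcal L$ into $k\ge 3$ nonempty classes $\mathcal L_1,\dots,\mathcal L_k$, and a set $\mathcal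 X$ of points, each lying on at least three lines of $\mathcal L$, such that (i) $\sum_{\ell\in\mathcal L_i}m(\ell)=d$ for every $i$; (ii) lines of different classes meet in a point of $\mathcal X$; (iii) for every $p\in\mathcal X$, the sum $\sum_{\ell\in\mathcal L_i,\,p\in\ell}m(\ell)$ is independent of $i$; (iv) for every $i$ and all $\ell,\ell'\in\mathcal L_i$ there is a sequence $\ell=\ell_0,\ell_1,\dots,\ell_r=\ell'$ of lines of $\mathcal L$ such that $\ell_{j-1}\ne\ell_j$ and $\ell_{j-1}\cap\ell_j\notin\mathcal X$ for $1\le j\le r$. **Proposition 3.13.** The exponents of any two distinct completely reducible fibers of a pencil of Ceva type are relatively prime. As a corollary, in every $(k,d)$-multinet whose line multiplicities are normalized so that $\gcd\{m(\ell):\ell\in\mathcal L\}=1$, the integers $\gcd\{m(\ell):\ell\in\mathcal L_i\}$, $i=1,\dots,k$, are pairwise relatively prime. -/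

import Mathlib

open scoped LinearAlgebra.Projectivization

noncomputable section

namespace CevaPencil

/-- The classical (quotient) topology on complex projective space. -/
instance projTopology (n : ℕ) : TopologicalSpace (ℙ ℂ (Fin n → ℂ)) :=
  inferInstanceAs (TopologicalSpace (Quotient (projectivizationSetoid ℂ (Fin n → ℂ))))

/-- The complex projective line. -/
abbrev P1 : Type := ℙ ℂ (Fin 2 → ℂ)

/-- The complex projective plane. -/
abbrev P2 : Type := ℙ ℂ (Fin 3 → ℂ)

/-- Lines of the projective plane, i.e. points of the dual plane: `[a : b : c]` stands for the
line `a x + b y + c z = 0`. -/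
abbrev Line : Type := ℙ ℂ (Fin 3 → ℂ)

/-- The point `p` lies on the line `l`. -/
def OnLine (p : P2) (l : Line) : Prop := Projectivization.orthogonal l p

/-! ### Pencils of plane curves -/

/-- A pencil of plane curves of degree `d` without fixed components, given by two of its
members: two linearly independent forms of degree `d` with no common factor. -/
structure Pencil where
  d : ℕ
  C₁ : MvPolynomial (Fin 3) ℂ
  C₂ : MvPolynomial (Fin 3) ℂ
  homogeneous₁ : C₁.IsHomogeneous d
  homogeneous₂ : C₂.IsHomogeneous d
  linearIndependent : LinearIndependent ℂ ![C₁, C₂]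
  no_fixed_component : IsRelPrime C₁ C₂

namespace Pencil

variable (P : Pencil)

/-- The member (fiber) `a C₁ + b C₂` of the pencil over `[a : b]`; as usual, the equation of
this curve is determined up to a nonzero constant. -/
def fiber (t : P1) : MvPolynomial (Fin 3) ℂ :=
  MvPolynomial.C (t.rep 0) * P.C₁ + MvPolynomial.C (t.rep 1) * P.C₂

/-- The base of the pencil, `C₁ ∩ C₂`. -/
def base : Set P2 :=
  {p | MvPolynomial.eval p.rep P.C₁ = 0 ∧ MvPolynomial.eval p.rep P.C₂ = 0}

open scoped Classical in
/-- The rational map `p ↦ [C₂(p) : -C₁(p)]` to the projective line (with an arbitrary value on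
its indeterminacy locus, the base of the pencil). -/
def ratMap (p : P2) : P1 :=
  if h : ![MvPolynomial.eval p.rep P.C₂, -MvPolynomial.eval p.rep P.C₁] ≠ 0 then
    Projectivization.mk ℂ _ h
  else Classical.arbitrary P1

/-- The blow-up of the projective plane at the points of the (finite) base of the pencil: pairs
consisting of a point `q` and, for each base point `p`, a line `L p` through both `p` and `q`.
It is a subspace of the product of the plane with one dual plane for every base point. -/
def BlowUp : Type :=
  {s : P2 × (P.base → Line) // ∀ p : P.base, OnLine p.1 (s.2 p) ∧ OnLine s.1 (s.2 p)}

instance : TopologicalSpace P.BlowUp :=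
  inferInstanceAs (TopologicalSpace
    {s : P2 × (P.base → Line) // ∀ p : P.base, OnLine p.1 (s.2 p) ∧ OnLine s.1 (s.2 p)})

/-- The blow-down map. -/
def blowDown (s : P.BlowUp) : P2 := s.1.1

/-- The lift of the rational map of the pencil to the blow-up: its extension by continuity from
the complement of the exceptional curves. -/
def lift : P.BlowUp → P1 :=
  extendFrom {s | P.blowDown s ∉ P.base} (fun s => P.ratMap (P.blowDown s))

/-- The pencil is connected: every fiber of its lift to the blow-up is connected. -/
def IsConnectedPencil : Prop := ∀ t : P1, IsConnected (P.lift ⁻¹' {t})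

end Pencil

/-- A factorization `F = c ∏ αᵢ ^ mᵢ` of a form into powers, with positive exponents, of
pairwise nonproportional (nonzero) linear forms. -/
structure LinearFactorization (F : MvPolynomial (Fin 3) ℂ) where
  q : ℕ
  c : ℂ
  α : Fin q → MvPolynomial (Fin 3) ℂ
  m : Fin q → ℕ
  c_ne_zero : c ≠ 0
  homogeneous : ∀ i, (α i).IsHomogeneous 1
  ne_zero : ∀ i, α i ≠ 0
  nonproportional : ∀ i j, i ≠ j → ∀ a : ℂ, α i ≠ MvPolynomial.C a * α j
  m_pos : ∀ i, 0 < m i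
  eq_prod : F = MvPolynomial.C c * ∏ i, α i ^ m i

/-- The greatest common divisor of the multiplicities of the linear factors. -/
def LinearFactorization.exponent {F : MvPolynomial (Fin 3) ℂ} (f : LinearFactorization F) : ℕ :=
  Finset.univ.gcd f.m

/-- A curve is completely reducible if it is a product of linear forms. -/
def IsCompletelyReducible (F : MvPolynomial (Fin 3) ℂ) : Prop := Nonempty (LinearFactorization F)

/-- A pencil of Ceva type: a connected pencil with no fixed components having (at least) three
completely reducible fibers. -/
def Pencil.IsCeva (P : Pencil) : Prop :=
  P.IsConnectedPencil ∧
    ∃ t : Fin 3 → P1, Function.Injective t ∧ ∀ i, IsCompletelyReducible (P.fiber (t i))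

/-! ### Multinets -/

/-- A finite arrangement of lines in the projective plane with positive multiplicities. -/
structure MultiArrangement where
  lines : Finset Line
  mult : Line → ℕ
  mult_pos : ∀ l ∈ lines, 0 < mult l

open scoped Classical in
/-- A weak `(k, d)`-multinet on a multi-arrangement: a partition of the lines into `k ≥ 3`
(nonempty) classes and a set `X` of multiple points. -/
structure IsWeakMultinet (A : MultiArrangement) (k d : ℕ) (cls : Fin k → Finset Line)
    (X : Set P2) : Prop where
  three_le : 3 ≤ k
  nonempty : ∀ i, (cls i).Nonempty
  disjoint : ∀ i j, i ≠ j → Disjoint (cls i) (cls j)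
  mem_lines : ∀ l, l ∈ A.lines ↔ ∃ i, l ∈ cls i
  multiple : ∀ p ∈ X, 3 ≤ (A.lines.filter (fun l => OnLine p l)).card
  sum_eq : ∀ i, ∑ l ∈ cls i, A.mult l = d
  inter_mem : ∀ i j, i ≠ j → ∀ l ∈ cls i, ∀ l' ∈ cls j, ∀ p, OnLine p l → OnLine p l' → p ∈ X
  local_sum : ∀ p ∈ X, ∃ n : ℕ, ∀ i, ∑ l ∈ (cls i).filter (fun l => OnLine p l), A.mult l = n

/-- A `(k, d)`-multinet: a weak multinet such that any two lines of the same class are joined by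
a chain of lines of the arrangement in which successive lines meet outside `X`. -/
structure IsMultinet (A : MultiArrangement) (k d : ℕ) (cls : Fin k → Finset Line)
    (X : Set P2) : Prop extends IsWeakMultinet A k d cls X where
  chain : ∀ i, ∀ l ∈ cls i, ∀ l' ∈ cls i, Relation.ReflTransGen
    (fun a b => a ∈ A.lines ∧ b ∈ A.lines ∧ a ≠ b ∧ ∀ p, OnLine p a → OnLine p b → p ∉ X) l l'

end CevaPencil

end

/-! Both halves rest on one identity. If a prime p divides the exponents of two fibers, a third
completely reducible fiber is a combination of these two and, since constants have p-th roots,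
equals A^p - B^p = (A - B)(A^(p-1) + ... + B^(p-1)), where A^p and B^p are proportional to the two
fibers. At a common zero of the two factors, A = B and p B^(p-1) = 0, so A = B = 0. Hence the
factors meet only over the base, and a line common to both would be a fixed component. Connectedness
of the third fiber forbids such a splitting.

For pencils, connectedness concerns the lift to the blow-up. Three completely reducible fibers have
the same multiplicity at every base point (`localMult_fiber_eq`), so the map extends over the
exceptional curves by its leading terms, and the fiber of the lift is covered by the strict
transforms of the lines of the third fiber (`form_lineAt_dvd_of_lift_eq`,
`mem_strictTransform_of_lift_eq`). These are finitely many closed sets, so a line of one factor and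
a line of the other have strict transforms that meet (`exists_common_of_mul_eq_fiber`). They meet
over the base, where this makes the two lines equal: a contradiction.

For multinets a pencil must first be constructed. On a line of one class the products of two other
classes are proportional, so the Jacobian determinant of three class products is divisible by all
three; its degree is too small, and it vanishes (`IsLineNet.jac_eq_zero`). By Lüroth's theorem the
quotients of the products are then rational functions of a single f, and the chain axiom forces the
products to be powers (u - a v)^n, (u - b v)^n, (u - c v)^n with one common n
(`IsLineNet.exists_pencil`). If p divides all multiplicities of two classes but not of the third,
then p does not divide n, two members are p-th powers, and the identity splits the third against the
chain axiom (`IsLineNet.dvd_of_dvd`). So p would divide every multiplicity, against the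
normalization. -/

namespace CevaPencil

open MvPolynomial

/-! ### Linear forms -/

/-- The linear form with coefficient vector `a`. -/
noncomputable def linForm (a : Fin 3 → ℂ) : MvPolynomial (Fin 3) ℂ := ∑ i, C (a i) * X i

@[simp] lemma eval_linForm (a x : Fin 3 → ℂ) : eval x (linForm a) = a ⬝ᵥ x := by
  simp [linForm, dotProduct]

@[simp] lemma pderiv_linForm (a : Fin 3 → ℂ) (i : Fin 3) : pderiv i (linForm a) = C (a i) := by
  simp [linForm, pderiv_X, Pi.single_apply]

lemma linForm_isHomogeneous (a : Fin 3 → ℂ) : (linForm a).IsHomogeneous 1 := by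
  refine IsHomogeneous.sum _ _ _ fun i _ => ?_
  simpa using (isHomogeneous_C (Fin 3) (a i)).mul (isHomogeneous_X ℂ i)

lemma linForm_injective : Function.Injective linForm := by
  intro a b h
  funext i
  simpa using congrArg (fun p => eval 0 (pderiv i p)) h

lemma linForm_ne_zero {a : Fin 3 → ℂ} (ha : a ≠ 0) : linForm a ≠ 0 := by
  intro h
  exact ha (linForm_injective (h.trans (by simp [linForm])))

lemma linForm_smul (c : ℂ) (a : Fin 3 → ℂ) : linForm (c • a) = C c * linForm a := by
  simp [linForm, Finset.mul_sum, mul_assoc]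

lemma linForm_prime {a : Fin 3 → ℂ} (ha : a ≠ 0) : Prime (linForm a) := by
  rw [← UniqueFactorizationMonoid.irreducible_iff_prime]
  apply irreducible_of_totalDegree_eq_one
  · exact (linForm_isHomogeneous a).totalDegree (linForm_ne_zero ha)
  · intro x hx
    rw [isUnit_iff_ne_zero]
    rintro rfl
    exact linForm_ne_zero ha (ext _ _ fun m => by simpa using hx m)

lemma exists_linForm_of_isHomogeneous {F : MvPolynomial (Fin 3) ℂ} (hF : F.IsHomogeneous 1) :
    ∃ a, F = linForm a := by
  have h := hF.sum_X_mul_pderiv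
  have h0 : ∀ i, (pderiv i F).totalDegree = 0 := fun i => by
    by_cases hz : pderiv i F = 0
    · simp [hz]
    · exact (hF.pderiv (i := i)).totalDegree hz
  refine ⟨fun i => coeff 0 (pderiv i F), ?_⟩
  rw [one_smul] at h
  conv_lhs => rw [← h]
  refine Finset.sum_congr rfl fun i _ => ?_
  rw [mul_comm, ← totalDegree_eq_zero_iff_eq_C.1 (h0 i)]

/-- Elimination: solving the equation of the plane for a variable `X j` with `a j ≠ 0` gives a
substitution that changes no polynomial modulo `linForm a`. It kills `H`, because its values are
values of `H` on the plane. -/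
lemma linForm_dvd_iff {a : Fin 3 → ℂ} (ha : a ≠ 0) {H : MvPolynomial (Fin 3) ℂ} :
    linForm a ∣ H ↔ ∀ x, a ⬝ᵥ x = 0 → eval x H = 0 := by
  constructor
  · rintro ⟨K, rfl⟩ x hx
    simp [hx]
  · intro h
    obtain ⟨j, hj⟩ := Function.ne_iff.1 ha
    simp only [Pi.zero_apply] at hj
    let s : Fin 3 → MvPolynomial (Fin 3) ℂ :=
      Function.update X j (X j - C (a j)⁻¹ * linForm a)
    have hs : bind₁ s H = 0 := by
      refine MvPolynomial.funext fun x => ?_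
      rw [map_zero, eval, eval₂Hom_bind₁]
      refine h _ ?_
      have : ∀ i, eval₂Hom (RingHom.id ℂ) x (s i) =
          x i - (Pi.single j ((a j)⁻¹ * (a ⬝ᵥ x)) : Fin 3 → ℂ) i := fun i => by
        by_cases hij : i = j
        · subst hij
          simp [s]
        · simp [s, hij]
      rw [show (fun i => eval₂Hom (RingHom.id ℂ) x (s i)) = _ from funext this]
      change a ⬝ᵥ (x - Pi.single j _) = 0
      rw [dotProduct_sub, dotProduct_single, mul_inv_cancel_left₀ hj, sub_self]
    have key : ∀ G : MvPolynomial (Fin 3) ℂ, linForm a ∣ G - bind₁ s G := fun G => by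
      induction G using MvPolynomial.induction_on with
      | C c => simp
      | add p q hp hq => simpa [add_sub_add_comm] using dvd_add hp hq
      | mul_X p i hp =>
        have h1 : linForm a ∣ X i - s i := by
          by_cases hij : i = j
          · subst hij; simp [s]
          · simp [s, hij]
        have : p * X i - bind₁ s (p * X i) = (p - bind₁ s p) * X i + bind₁ s p * (X i - s i) := by
          simp; ring
        rw [this]
        exact dvd_add (hp.mul_right _) (h1.mul_left _)
    simpa [hs] using key H

lemma exists_smul_of_linForm_dvd {a b : Fin 3 → ℂ} (ha : a ≠ 0) (hb : b ≠ 0)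
    (h : linForm a ∣ linForm b) : ∃ c : ℂ, c ≠ 0 ∧ b = c • a := by
  obtain ⟨K, hK⟩ := h
  have hK0 : K ≠ 0 := by rintro rfl; exact linForm_ne_zero hb (by simpa using hK)
  have hd := totalDegree_mul_of_isDomain (linForm_ne_zero ha) hK0
  rw [← hK, (linForm_isHomogeneous a).totalDegree (linForm_ne_zero ha),
    (linForm_isHomogeneous b).totalDegree (linForm_ne_zero hb)] at hd
  rw [totalDegree_eq_zero_iff_eq_C.1 (by omega : K.totalDegree = 0), mul_comm,
    ← linForm_smul] at hK
  have hb' := linForm_injective hK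
  refine ⟨_, ?_, hb'⟩
  intro hc
  rw [hc, zero_smul] at hb'
  exact hb hb'

/-- The linear form defining a line. -/
noncomputable def Line.form (l : Line) : MvPolynomial (Fin 3) ℂ := linForm l.rep

lemma Line.form_prime (l : Line) : Prime l.form := linForm_prime l.rep_nonzero

lemma Line.eq_of_dvd {l l' : Line} (h : l.form ∣ l'.form) : l = l' := by
  obtain ⟨c, hc, h⟩ := exists_smul_of_linForm_dvd l.rep_nonzero l'.rep_nonzero h
  rw [← l.mk_rep, ← l'.mk_rep, Projectivization.mk_eq_mk_iff']
  exact ⟨c⁻¹, by rw [h, smul_smul, inv_mul_cancel₀ hc, one_smul]⟩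

lemma onLine_iff (p : P2) (l : Line) : OnLine p l ↔ l.rep ⬝ᵥ p.rep = 0 := by
  conv_lhs => rw [OnLine, ← l.mk_rep, ← p.mk_rep]
  exact Projectivization.orthogonal_mk _ _

lemma onLine_mk {x a : Fin 3 → ℂ} (hx : x ≠ 0) (ha : a ≠ 0) :
    OnLine (Projectivization.mk ℂ x hx) (Projectivization.mk ℂ a ha) ↔ a ⬝ᵥ x = 0 :=
  Projectivization.orthogonal_mk _ _

lemma onLine_mk_left {x : Fin 3 → ℂ} (hx : x ≠ 0) (l : Line) :
    OnLine (Projectivization.mk ℂ x hx) l ↔ l.rep ⬝ᵥ x = 0 := by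
  conv_lhs => rw [← l.mk_rep]
  exact onLine_mk _ _

lemma exists_onLine_onLine {l l' : Line} (h : l ≠ l') : ∃ p : P2, OnLine p l ∧ OnLine p l' := by
  classical
  exact ⟨Projectivization.cross l l', Projectivization.orthogonal_cross_left h,
    Projectivization.orthogonal_cross_right h⟩

end CevaPencil

namespace CevaPencil

open MvPolynomial

/-! ### Products of lines -/

/-- The product of the lines in `S` with multiplicities `m`. -/
noncomputable def lineProd (m : Line → ℕ) (S : Finset Line) : MvPolynomial (Fin 3) ℂ :=
  ∏ l ∈ S, l.form ^ m l

lemma lineProd_ne_zero (m : Line → ℕ) (S : Finset Line) : lineProd m S ≠ 0 :=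
  Finset.prod_ne_zero_iff.2 fun l _ => pow_ne_zero _ l.form_prime.ne_zero

lemma lineProd_isHomogeneous (m : Line → ℕ) (S : Finset Line) :
    (lineProd m S).IsHomogeneous (∑ l ∈ S, m l) := by
  refine IsHomogeneous.prod _ _ _ fun l _ => ?_
  simpa [Line.form] using (linForm_isHomogeneous l.rep).pow (m l)

lemma mem_of_form_dvd_lineProd {m : Line → ℕ} {S : Finset Line} {l : Line}
    (h : l.form ∣ lineProd m S) : l ∈ S := by
  obtain ⟨l', hl', h⟩ := (l.form_prime.dvd_finsetProd_iff _).1 h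
  rwa [Line.eq_of_dvd (l.form_prime.dvd_of_dvd_pow h)]

lemma form_dvd_lineProd {m : Line → ℕ} {S : Finset Line} {l : Line} (hl : l ∈ S) (hm : 0 < m l) :
    l.form ∣ lineProd m S :=
  (dvd_pow_self _ hm.ne').trans (Finset.dvd_prod_of_mem (fun l : Line => l.form ^ m l) hl)

lemma exists_onLine_of_eval_lineProd {m : Line → ℕ} {S : Finset Line} {p : P2}
    (h : eval p.rep (lineProd m S) = 0) : ∃ l ∈ S, OnLine p l := by
  rw [lineProd, map_prod, Finset.prod_eq_zero_iff] at h
  obtain ⟨l, hl, h⟩ := h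
  rw [map_pow] at h
  exact ⟨l, hl, (onLine_iff p l).2 (by simpa [Line.form] using eq_zero_of_pow_eq_zero h)⟩

lemma exists_form_dvd_of_dvd_lineProd {m : Line → ℕ} {S : Finset Line}
    {D : MvPolynomial (Fin 3) ℂ} (hD : ¬ IsUnit D) (h : D ∣ lineProd m S) :
    ∃ l ∈ S, l.form ∣ D := by
  have hD0 : D ≠ 0 := ne_zero_of_dvd_ne_zero (lineProd_ne_zero m S) h
  obtain ⟨q, hq, hqD⟩ := WfDvdMonoid.exists_irreducible_factor hD hD0
  rw [UniqueFactorizationMonoid.irreducible_iff_prime] at hq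
  obtain ⟨l, hl, h⟩ := (hq.dvd_finsetProd_iff _).1 (hqD.trans h)
  have := (hq.irreducible.associated_of_dvd l.form_prime.irreducible (hq.dvd_of_dvd_pow h))
  exact ⟨l, hl, this.symm.dvd.trans hqD⟩

lemma lineProd_isRelPrime {m : Line → ℕ} {S T : Finset Line} (h : Disjoint S T) :
    IsRelPrime (lineProd m S) (lineProd m T) := by
  intro D h1 h2
  by_contra hD
  obtain ⟨l, hl, hlD⟩ := exists_form_dvd_of_dvd_lineProd hD h1
  exact Finset.disjoint_left.1 h hl (mem_of_form_dvd_lineProd (hlD.trans h2))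

/-- Restricted to `l`, both products are binary forms of the same degree with the same zeros and
multiplicities, hence proportional. The constant is their ratio at a point `y` of `l` where neither
vanishes. -/
lemma exists_form_dvd_sub {m : Line → ℕ} {S T : Finset Line} {l : Line} (hS : l ∉ S) (hT : l ∉ T)
    (hsum : ∑ l' ∈ S, m l' = ∑ l' ∈ T, m l')
    (hloc : ∀ p, OnLine p l → ∀ (_ : DecidablePred fun l' => OnLine p l'),
      ∑ l' ∈ S with OnLine p l', m l' = ∑ l' ∈ T with OnLine p l', m l') :
    ∃ γ : ℂ, l.form ∣ lineProd m S - C γ * lineProd m T := by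
  classical
  obtain ⟨y, hy, hy0⟩ : ∃ y, l.rep ⬝ᵥ y = 0 ∧ eval y (lineProd m S * lineProd m T) ≠ 0 := by
    by_contra! h
    rcases l.form_prime.dvd_or_dvd ((linForm_dvd_iff l.rep_nonzero).2 h) with h | h
    · exact hS (mem_of_form_dvd_lineProd h)
    · exact hT (mem_of_form_dvd_lineProd h)
  rw [map_mul, mul_ne_zero_iff] at hy0
  refine ⟨eval y (lineProd m S) / eval y (lineProd m T), (linForm_dvd_iff l.rep_nonzero).2 ?_⟩
  intro x hx
  -- `r l'` is the parameter t for which `l'` passes through x - t y, so grouping the factors by `r`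
  -- groups the lines by the point where they meet `l`.
  let r : Line → ℂ := fun l' => (l'.rep ⬝ᵥ x) / (l'.rep ⬝ᵥ y)
  let V : Finset ℂ := S.image r ∪ T.image r
  have key : ∀ U : Finset Line, U.image r ⊆ V → eval y (lineProd m U) ≠ 0 →
      eval x (lineProd m U) / eval y (lineProd m U) =
        ∏ t ∈ V, t ^ (∑ l' ∈ U with r l' = t, m l') := fun U hU hUy => by
    rw [lineProd, map_prod, map_prod, ← Finset.prod_div_distrib,
      ← Finset.prod_fiberwise_of_maps_to (t := V) (g := r)
        fun i hi => hU (Finset.mem_image_of_mem r hi)]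
    refine Finset.prod_congr rfl fun t _ => ?_
    rw [← Finset.prod_pow_eq_pow_sum]
    refine Finset.prod_congr rfl fun l' hl' => ?_
    rw [← (Finset.mem_filter.1 hl').2]
    simp [r, Line.form, div_pow]
  have hr : ∀ U : Finset Line, eval y (lineProd m U) ≠ 0 → ∀ t, ∀ l' ∈ U, 0 < m l' →
      (r l' = t ↔ l'.rep ⬝ᵥ (x - t • y) = 0) := fun U hU t l' hl' hm => by
    have : l'.rep ⬝ᵥ y ≠ 0 := fun h => hU <| by
      obtain ⟨K, hK⟩ := form_dvd_lineProd hl' hm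
      rw [hK, map_mul, Line.form, eval_linForm, h, zero_mul]
    rw [dotProduct_sub, dotProduct_smul, smul_eq_mul, sub_eq_zero, div_eq_iff this]
  have hfil : ∀ U : Finset Line, eval y (lineProd m U) ≠ 0 → ∀ t,
      ∑ l' ∈ U with r l' = t, m l' = ∑ l' ∈ U with l'.rep ⬝ᵥ (x - t • y) = 0, m l' :=
    fun U hU t => by
      rw [Finset.sum_filter, Finset.sum_filter]
      refine Finset.sum_congr rfl fun l' hl' => ?_
      rcases Nat.eq_zero_or_pos (m l') with h0 | h0
      · simp [h0]
      · simp only [hr U hU t l' hl' h0]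
  have heq : eval x (lineProd m S) / eval y (lineProd m S) =
      eval x (lineProd m T) / eval y (lineProd m T) := by
    rw [key S Finset.subset_union_left hy0.1, key T Finset.subset_union_right hy0.2]
    refine Finset.prod_congr rfl fun t _ => ?_
    rw [hfil S hy0.1, hfil T hy0.2]
    congr 1
    -- If x is a multiple of y, every line satisfies the condition and the total degrees are
    -- compared instead of local sums.
    by_cases h0 : x - t • y = 0
    · simpa [h0] using hsum
    · have hl : OnLine (Projectivization.mk ℂ _ h0) l := (onLine_mk_left h0 l).2 (by
        rw [dotProduct_sub, dotProduct_smul, hx, hy, smul_zero, sub_zero])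
      simpa only [onLine_mk_left] using hloc _ hl (Classical.decPred _)
  rw [map_sub, map_mul, eval_C]
  rw [div_eq_div_iff hy0.1 hy0.2] at heq
  field_simp [hy0.2]
  linear_combination heq

/-! ### Jacobian determinants -/

/-- The gradient of a polynomial. -/
noncomputable def grad (F : MvPolynomial (Fin 3) ℂ) : Fin 3 → MvPolynomial (Fin 3) ℂ :=
  fun i => pderiv i F

/-- The Jacobian determinant of three polynomials, as a derivation in the first one. -/
noncomputable def jac (G H : MvPolynomial (Fin 3) ℂ) :
    Derivation ℂ (MvPolynomial (Fin 3) ℂ) (MvPolynomial (Fin 3) ℂ) :=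
  mkDerivation ℂ (crossProduct (grad G) (grad H))

lemma jac_apply (F G H : MvPolynomial (Fin 3) ℂ) :
    jac G H F = grad F ⬝ᵥ crossProduct (grad G) (grad H) := by
  have : jac G H = ∑ i, crossProduct (grad G) (grad H) i • pderiv i := by
    refine MvPolynomial.derivation_ext fun j => ?_
    fin_cases j <;> simp [jac, Fin.sum_univ_three, pderiv_X]
  rw [this]
  simp [dotProduct, grad, mul_comm, Fin.sum_univ_three]

lemma jac_rotate (F G H : MvPolynomial (Fin 3) ℂ) : jac G H F = jac H F G := by
  simp only [jac_apply]
  exact triple_product_permutation _ _ _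

lemma jac_self_left (G H : MvPolynomial (Fin 3) ℂ) : jac G H G = 0 := by
  simp [jac_apply]

lemma jac_self_right (G H : MvPolynomial (Fin 3) ℂ) : jac G H H = 0 := by
  simp [jac_apply]

/-- Differentiating a^n loses one factor a. It is regained because modulo `a` the differential of
`G` is a combination of those of `H` and `a`, so that the derivation `jac G H` sends `a` to a
multiple of `a`. -/
lemma pow_dvd_jac {a K M F G H : MvPolynomial (Fin 3) ℂ} {n : ℕ} {c : ℂ} (hF : F = a ^ n * K)
    (hG : G - C c * H = a * M) : a ^ n ∣ jac G H F := by
  cases n with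
  | zero => simp
  | succ n =>
    have hG' : G = a * M + C c * H := by rw [← hG]; ring
    have h1 : jac G H a = a * jac M H a := by
      rw [jac_rotate, hG', map_add, Derivation.leibniz, Derivation.leibniz, jac_self_left,
        jac_self_right, derivation_C, ← jac_rotate a M H]
      simp
    rw [hF, Derivation.leibniz, Derivation.leibniz_pow, h1]
    simp only [smul_eq_mul, nsmul_eq_mul, Nat.add_sub_cancel]
    exact ⟨jac G H K + (n + 1 : ℕ) * K * jac M H a, by ring⟩

lemma jac_isHomogeneous {F G H : MvPolynomial (Fin 3) ℂ} {d : ℕ} (hF : F.IsHomogeneous d)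
    (hG : G.IsHomogeneous d) (hH : H.IsHomogeneous d) :
    (jac G H F).IsHomogeneous ((d - 1) + ((d - 1) + (d - 1))) := by
  rw [jac_apply]
  have h : ∀ i j : Fin 3, (pderiv i G * pderiv j H - pderiv j G * pderiv i H).IsHomogeneous
      ((d - 1) + (d - 1)) := fun i j =>
    ((hG.pderiv).mul hH.pderiv).sub ((hG.pderiv).mul hH.pderiv)
  refine IsHomogeneous.sum _ _ _ fun i _ => (hF.pderiv).mul ?_
  fin_cases i
  · simpa [cross_apply, grad] using h 1 2
  · simpa [cross_apply, grad, mul_comm] using h 2 0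
  · simpa [cross_apply, grad] using h 0 1

end CevaPencil

namespace CevaPencil

open MvPolynomial

/-! ### Connected families of line classes -/

/-- Classes of lines with multiplicities that satisfy the axioms of a multinet, the connectedness
axiom being stated as an induction principle. -/
structure IsLineNet {ι : Type*} (m : Line → ℕ) (S : ι → Finset Line) (X : Set P2) : Prop where
  pos : ∀ i, ∀ l ∈ S i, 0 < m l
  nonempty : ∀ i, (S i).Nonempty
  disjoint : ∀ i j, i ≠ j → Disjoint (S i) (S j)
  sum_eq : ∀ i j, ∑ l ∈ S i, m l = ∑ l ∈ S j, m l
  local_sum : ∀ p ∈ X, ∀ (_ : DecidablePred fun l => OnLine p l), ∀ i j,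
    ∑ l ∈ S i with OnLine p l, m l = ∑ l ∈ S j with OnLine p l, m l
  inter_mem : ∀ i j, i ≠ j → ∀ l ∈ S i, ∀ l' ∈ S j, ∀ p, OnLine p l → OnLine p l' → p ∈ X
  connected : ∀ i (Q : Line → Prop), (∀ l ∈ S i, ∀ l' ∈ S i, ∀ p ∉ X, OnLine p l → OnLine p l' →
    Q l → Q l') → ∀ l ∈ S i, Q l → ∀ l' ∈ S i, Q l'

namespace IsLineNet

variable {ι : Type*} {m : Line → ℕ} {S : ι → Finset Line} {X : Set P2}

lemma degree_pos (h : IsLineNet m S X) (i : ι) : 0 < ∑ l ∈ S i, m l :=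
  Finset.sum_pos (h.pos i) (h.nonempty i)

lemma pow_form_dvd_jac (h : IsLineNet m S X) {i j k : ι} (hij : i ≠ j) (hik : i ≠ k) {l : Line}
    (hl : l ∈ S i) :
    l.form ^ m l ∣ jac (lineProd m (S j)) (lineProd m (S k)) (lineProd m (S i)) := by
  obtain ⟨K, hK⟩ := Finset.dvd_prod_of_mem (fun l : Line => l.form ^ m l) hl
  obtain ⟨γ, M, hM⟩ : ∃ γ : ℂ, l.form ∣ lineProd m (S j) - C γ * lineProd m (S k) := by
    refine exists_form_dvd_sub (Finset.disjoint_left.1 (h.disjoint i j hij) hl)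
      (Finset.disjoint_left.1 (h.disjoint i k hik) hl) (h.sum_eq j k) fun p hp dec => ?_
    -- Outside `X` no line of another class passes through a point of `l`, and both local sums are
    -- empty.
    by_cases hX : p ∈ X
    · exact h.local_sum p hX dec j k
    · rw [Finset.filter_false_of_mem fun l' hl' hp' =>
        hX (h.inter_mem i j hij l hl l' hl' p hp hp'), Finset.filter_false_of_mem fun l' hl' hp' =>
        hX (h.inter_mem i k hik l hl l' hl' p hp hp')]
  exact pow_dvd_jac hK hM

lemma lineProd_dvd_jac (h : IsLineNet m S X) {i j k : ι} (hij : i ≠ j) (hik : i ≠ k) :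
    lineProd m (S i) ∣ jac (lineProd m (S j)) (lineProd m (S k)) (lineProd m (S i)) := by
  refine Finset.prod_dvd_of_isRelPrime (fun l _ l' _ hll => ?_)
    fun l hl => h.pow_form_dvd_jac hij hik hl
  refine IsRelPrime.pow ?_
  exact l.form_prime.irreducible.isRelPrime_iff_not_dvd.2 fun hd => hll (Line.eq_of_dvd hd)

/-- The three pairwise coprime products, each of degree d > 0, all divide the Jacobian determinant,
which has degree 3(d - 1) < 3d if nonzero. -/
lemma jac_eq_zero (h : IsLineNet m S X) {i j k : ι} (hij : i ≠ j) (hik : i ≠ k) (hjk : j ≠ k) :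
    jac (lineProd m (S j)) (lineProd m (S k)) (lineProd m (S i)) = 0 := by
  by_contra h0
  have hi := h.lineProd_dvd_jac hij hik
  have hj := h.lineProd_dvd_jac hjk hij.symm
  have hk := h.lineProd_dvd_jac hik.symm hjk.symm
  rw [← jac_rotate] at hj
  rw [jac_rotate] at hk
  have hprod := ((lineProd_isRelPrime (h.disjoint i j hij) (m := m)).mul_dvd hi hj)
  have := ((lineProd_isRelPrime (h.disjoint i k hik) (m := m)).mul_left
    (lineProd_isRelPrime (h.disjoint j k hjk) (m := m))).mul_dvd hprod hk
  obtain ⟨Q, hQ⟩ := this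
  have hdeg : ∀ a, (lineProd m (S a)).IsHomogeneous (∑ l ∈ S i, m l) := fun a => by
    rw [h.sum_eq i a]; exact lineProd_isHomogeneous m (S a)
  have h1 := ((jac_isHomogeneous (hdeg i) (hdeg j) (hdeg k)).totalDegree h0)
  have hP := ((hdeg i).mul (hdeg j)).mul (hdeg k)
  have hP0 := mul_ne_zero (mul_ne_zero (lineProd_ne_zero m (S i)) (lineProd_ne_zero m (S j)))
    (lineProd_ne_zero m (S k))
  have hQ0 : Q ≠ 0 := by rintro rfl; exact h0 (by rw [hQ, mul_zero])
  have h2 := totalDegree_mul_of_isDomain hP0 hQ0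
  rw [← hQ, h1, hP.totalDegree hP0] at h2
  have := h.degree_pos i
  omega

end IsLineNet
end CevaPencil

namespace CevaPencil

open MvPolynomial

/-! ### Rational functions with vanishing Jacobian -/

/-- Lüroth's theorem for a family of elements of an arbitrary field satisfying the same algebraic
relations as a family of rational functions in one variable. -/
lemma exists_aeval_div_aeval_of_ker_eq {A K : Type*} [CommRing A] [Algebra ℂ A] [Field K]
    [Algebra ℂ K] (θ : A →ₐ[ℂ] RatFunc ℂ) (Θ : A →ₐ[ℂ] K) (hker : ∀ a, θ a = 0 ↔ Θ a = 0) :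
    ∃ h : K, ∀ a, ∃ P Q : Polynomial ℂ, Θ a = Polynomial.aeval h P / Polynomial.aeval h Q := by
  let I := RingHom.ker θ
  have hI : I.IsPrime := RingHom.ker_isPrime θ
  let θ' : A ⧸ I →ₐ[ℂ] RatFunc ℂ := Ideal.Quotient.liftₐ I θ fun a ha => ha
  let Θ' : A ⧸ I →ₐ[ℂ] K := Ideal.Quotient.liftₐ I Θ fun a ha => (hker a).1 ha
  have hθ' : Function.Injective θ' := by
    rw [injective_iff_map_eq_zero]
    intro x hx
    obtain ⟨a, rfl⟩ := Ideal.Quotient.mk_surjective x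
    exact Ideal.Quotient.eq_zero_iff_mem.2 hx
  have hΘ' : Function.Injective Θ' := by
    rw [injective_iff_map_eq_zero]
    intro x hx
    obtain ⟨a, rfl⟩ := Ideal.Quotient.mk_surjective x
    exact Ideal.Quotient.eq_zero_iff_mem.2 ((hker a).2 hx)
  let T := FractionRing (A ⧸ I)
  let t : T →ₐ[ℂ] RatFunc ℂ := IsFractionRing.liftAlgHom (K := T) hθ'
  let t' : T →ₐ[ℂ] K := IsFractionRing.liftAlgHom (K := T) hΘ'
  -- The fraction field `T` of the common quotient embeds in both fields. Lüroth's theorem applies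
  -- to its image in the rational functions, and the generator is carried to `K` through `T`.
  obtain ⟨h₀, hh₀⟩ : RatFunc.Luroth.generator t.fieldRange ∈ t.fieldRange :=
    RatFunc.Luroth.generator_mem
  refine ⟨t' h₀, fun a => ?_⟩
  have hmem : t (algebraMap _ T (Ideal.Quotient.mk I a)) ∈ t.fieldRange := ⟨_, rfl⟩
  rw [RatFunc.Luroth.eq_adjoin_generator (E := t.fieldRange),
    IntermediateField.mem_adjoin_simple_iff] at hmem
  obtain ⟨P, Q, hPQ⟩ := hmem
  change t h₀ = _ at hh₀
  rw [← hh₀, Polynomial.aeval_algHom_apply, Polynomial.aeval_algHom_apply, ← map_div₀] at hPQ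
  refine ⟨P, Q, ?_⟩
  have := congrArg t' (t.injective hPQ)
  rw [map_div₀, ← Polynomial.aeval_algHom_apply, ← Polynomial.aeval_algHom_apply] at this
  rw [← this]
  exact (IsFractionRing.lift_algebraMap (K := T) hΘ' (Ideal.Quotient.mk I a)).symm

lemma exists_eq_smul_add_smul {p q x : Fin 3 → ℂ} (hpq : crossProduct p q ≠ 0)
    (hx : crossProduct p q ⬝ᵥ x = 0) : ∃ s t : ℂ, x = s • p + t • q := by
  rw [dotProduct_comm, triple_product_eq_det] at hx
  obtain ⟨v, hv, h⟩ := (Matrix.exists_vecMul_eq_zero_iff (M := Matrix.of ![x, p, q])).2 hx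
  have h' : v 0 • x + v 1 • p + v 2 • q = 0 := by
    rw [← h]
    funext i
    fin_cases i <;> simp [Matrix.vecMul, dotProduct, Fin.sum_univ_three]
  have h0 : v 0 ≠ 0 := by
    intro h0
    rw [h0, zero_smul, zero_add] at h'
    have h1 := congrArg (fun y => crossProduct y q) h'
    have h2 := congrArg (fun y => crossProduct p y) h'
    simp [hpq] at h1 h2
    apply hv
    funext i
    fin_cases i <;> assumption
  refine ⟨-(v 0)⁻¹ * v 1, -(v 0)⁻¹ * v 2, ?_⟩
  have := congrArg (fun y => (v 0)⁻¹ • y) h'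
  simp only [smul_add, smul_smul, inv_mul_cancel₀ h0, one_smul, smul_zero] at this
  simp only [neg_mul, neg_smul]
  linear_combination this

lemma eval_smul_of_isHomogeneous {F : MvPolynomial (Fin 3) ℂ} {d : ℕ} (hF : F.IsHomogeneous d)
    (c : ℂ) (x : Fin 3 → ℂ) : eval (c • x) F = c ^ d * eval x F := by
  rw [eval_eq', eval_eq', Finset.mul_sum]
  refine Finset.sum_congr rfl fun m hm => ?_
  have := hF.degree_eq_sum_deg_support hm
  simp only [Pi.smul_apply, smul_eq_mul, mul_pow, Finset.prod_mul_distrib,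
    Finset.prod_pow_eq_pow_sum]
  rw [mul_left_comm]
  congr 2
  rw [this]
  exact (Finset.sum_subset (Finset.subset_univ _) fun i _ hi => by simpa using hi).symm

lemma exists_linForm_of_cross_ne_zero {p q : Fin 3 → ℂ} (hpq : crossProduct p q ≠ 0) :
    ∃ c : Fin 3 → ℂ, c ⬝ᵥ q = 0 ∧ c ⬝ᵥ p ≠ 0 := by
  obtain ⟨i, hi⟩ := Function.ne_iff.1 hpq
  refine ⟨crossProduct q (Pi.single i 1), ?_, ?_⟩
  · rw [dotProduct_comm, dot_self_cross]
  · rw [dotProduct_comm, triple_product_permutation, triple_product_permutation,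
      single_dotProduct, one_mul]
    exact hi

section

variable {C₁ C₂ C₃ : MvPolynomial (Fin 3) ℂ} {d : ℕ}

lemma dotProduct_eval_grad (h : C₁.IsHomogeneous d) (p : Fin 3 → ℂ) :
    p ⬝ᵥ (fun i => eval p (grad C₁ i)) = d * eval p C₁ := by
  simpa [dotProduct, grad] using congrArg (eval p) h.sum_X_mul_pderiv

/-- Otherwise coprimality makes `C₃` divide its own partial derivatives, which vanish by degree, and
Euler's identity gives `C₃ = 0`. -/
lemma exists_eval_wronskian_ne_zero (hd : 0 < d) (h₃ : C₃.IsHomogeneous d) (h0 : C₃ ≠ 0)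
    (hcop : IsRelPrime C₁ C₃) :
    ∃ j p, eval p (C₁ * pderiv j C₃ - C₃ * pderiv j C₁) ≠ 0 := by
  by_contra! h
  have hz : ∀ j, pderiv j C₃ = 0 := fun j => by
    by_contra hj
    have h1 : C₁ * pderiv j C₃ = C₃ * pderiv j C₁ :=
      sub_eq_zero.1 (MvPolynomial.funext fun p => by rw [h, map_zero])
    obtain ⟨Q, hQ⟩ := hcop.symm.dvd_of_dvd_mul_left ⟨_, h1⟩
    have hQ0 : Q ≠ 0 := by rintro rfl; exact hj (by rw [hQ, mul_zero])
    have := totalDegree_mul_of_isDomain h0 hQ0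
    rw [← hQ, h₃.totalDegree h0, h₃.pderiv.totalDegree hj] at this
    omega
  have := h₃.sum_X_mul_pderiv
  simp only [hz, mul_zero, Finset.sum_const_zero] at this
  rcases smul_eq_zero.1 this.symm with h | h
  · omega
  · exact h0 h

/-- By homogeneity `ρ` vanishes on the plane through the origin spanned by the line, so its linear
form n divides `ρ`. The derivation D = `jac C₁ C₃` is transverse to this plane: n does not divide D
n. Comparing powers of n in D ρ = 0 then excludes any positive finite order of vanishing. -/
lemma eq_zero_of_eval_line_eq_zero (hd : 0 < d) (h₁ : C₁.IsHomogeneous d)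
    (h₃ : C₃.IsHomogeneous d) {j : Fin 3} {p : Fin 3 → ℂ}
    (hW : eval p (C₁ * pderiv j C₃ - C₃ * pderiv j C₁) ≠ 0) {e : ℕ}
    {ρ : MvPolynomial (Fin 3) ℂ} (hρ : ρ.IsHomogeneous e) (hD : jac C₁ C₃ ρ = 0)
    (hline : ∀ t : ℂ, eval (p + t • Pi.single j 1) ρ = 0) : ρ = 0 := by
  set q : Fin 3 → ℂ := Pi.single j 1 with hq
  set n := crossProduct p q with hn
  -- By the Binet–Cauchy identity for cross products and Euler's identity, this value is d times the
  -- nonzero Wronskian at `p`.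
  have hDn : eval p (jac C₁ C₃ (linForm n)) ≠ 0 := by
    have : eval p (jac C₁ C₃ (linForm n)) = n ⬝ᵥ crossProduct (fun i => eval p (grad C₁ i))
        (fun i => eval p (grad C₃ i)) := by
      rw [jac_apply]
      simp only [cross_apply, dotProduct, Fin.sum_univ_three, grad, pderiv_linForm]
      simp
    rw [this, hn, cross_dot_cross, dotProduct_eval_grad h₁, dotProduct_eval_grad h₃, hq,
      single_dotProduct, single_dotProduct]
    intro h0
    apply hW
    have hd' : (d : ℂ) ≠ 0 := by exact_mod_cast hd.ne'
    refine (mul_eq_zero.1 (?_ : (d : ℂ) * _ = 0)).resolve_left hd'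
    rw [← h0]
    simp [grad]
    ring
  have hn0 : n ≠ 0 := by
    intro h
    rw [h] at hDn
    simp [linForm] at hDn
  have hpn : eval p (linForm n) = 0 := by
    rw [eval_linForm, dotProduct_comm, hn, dot_self_cross]
  have hdvd : linForm n ∣ ρ := by
    -- The multiples of `q` in the plane are not multiples of points of the affine line. The
    -- auxiliary factor `linForm c` vanishes there and is not divisible by n.
    obtain ⟨c, hcq, hcp⟩ := exists_linForm_of_cross_ne_zero hn0
    have : linForm n ∣ linForm c * ρ := by
      rw [linForm_dvd_iff hn0]
      intro x hx
      obtain ⟨s, t, rfl⟩ := exists_eq_smul_add_smul hn0 hx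
      rw [map_mul]
      by_cases hs : s = 0
      · simp [hs, hcq]
      · rw [show s • p + t • q = s • (p + (t / s) • q) by
          rw [smul_add, smul_smul, mul_div_cancel₀ _ hs], eval_smul_of_isHomogeneous hρ, hline]
        simp
    refine ((linForm_prime hn0).dvd_or_dvd this).resolve_left ?_
    rintro ⟨K, hK⟩
    have := congrArg (eval p) hK
    rw [map_mul, hpn, zero_mul, eval_linForm] at this
    exact hcp this
  by_contra h0
  obtain ⟨k, ρ', hρ', rfl⟩ := WfDvdMonoid.max_power_factor h0 (linForm_prime hn0).irreducible
  cases k with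
  | zero => exact hρ' (by simpa using hdvd)
  | succ k =>
    rw [Derivation.leibniz, Derivation.leibniz_pow] at hD
    simp only [smul_eq_mul, nsmul_eq_mul, Nat.add_sub_cancel] at hD
    have h1 : linForm n ^ k * (linForm n * jac C₁ C₃ ρ' +
        (k + 1 : ℕ) * (ρ' * jac C₁ C₃ (linForm n))) = 0 := by rw [← hD]; ring
    have h2 := (mul_eq_zero.1 h1).resolve_left (pow_ne_zero _ (linForm_ne_zero hn0))
    have h3 : linForm n ∣ (k + 1 : ℕ) * (ρ' * jac C₁ C₃ (linForm n)) :=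
      ⟨-jac C₁ C₃ ρ', by linear_combination h2⟩
    have hu : IsUnit ((k + 1 : ℕ) : MvPolynomial (Fin 3) ℂ) := by
      have : IsUnit ((k + 1 : ℕ) : ℂ) := isUnit_iff_ne_zero.2 (by exact_mod_cast k.succ_ne_zero)
      simpa using this.map (C : ℂ →+* MvPolynomial (Fin 3) ℂ)
    rw [hu.dvd_mul_left] at h3
    obtain ⟨Q, hQ⟩ := ((linForm_prime hn0).dvd_or_dvd h3).resolve_left hρ'
    rw [hQ, map_mul, hpn, zero_mul] at hDn
    exact hDn rfl

/-- The homogenization of a polynomial in two variables, evaluated at three forms. -/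
noncomputable def homogEval (C₁ C₂ C₃ : MvPolynomial (Fin 3) ℂ) (P : MvPolynomial (Fin 2) ℂ) :
    MvPolynomial (Fin 3) ℂ :=
  ∑ m ∈ P.support, C (coeff m P) * (C₁ ^ m 0 * C₂ ^ m 1 * C₃ ^ (P.totalDegree - (m 0 + m 1)))

lemma add_le_totalDegree {P : MvPolynomial (Fin 2) ℂ} {m : Fin 2 →₀ ℕ} (hm : m ∈ P.support) :
    m 0 + m 1 ≤ P.totalDegree := by
  have := le_totalDegree hm
  rwa [Finsupp.sum_fintype _ _ (fun _ => rfl), Fin.sum_univ_two] at this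

lemma homogEval_isHomogeneous (h₁ : C₁.IsHomogeneous d) (h₂ : C₂.IsHomogeneous d)
    (h₃ : C₃.IsHomogeneous d) (P : MvPolynomial (Fin 2) ℂ) :
    (homogEval C₁ C₂ C₃ P).IsHomogeneous (d * P.totalDegree) := by
  refine IsHomogeneous.sum _ _ _ fun m hm => ?_
  have := (isHomogeneous_C (Fin 3) (coeff m P)).mul (((h₁.pow (m 0)).mul (h₂.pow (m 1))).mul
    (h₃.pow (P.totalDegree - (m 0 + m 1))))
  convert this using 1
  rw [← mul_add, ← mul_add, zero_add, Nat.add_sub_cancel' (add_le_totalDegree hm)]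

lemma jac_homogEval (hJ : jac C₁ C₃ C₂ = 0) (P : MvPolynomial (Fin 2) ℂ) :
    jac C₁ C₃ (homogEval C₁ C₂ C₃ P) = 0 := by
  rw [homogEval, map_sum]
  refine Finset.sum_eq_zero fun m _ => ?_
  simp [Derivation.leibniz, Derivation.leibniz_pow, hJ, jac_self_left, jac_self_right,
    derivation_C]

lemma aeval_div_mul_pow {L : Type*} [Field L] [Algebra ℂ L] (τ : MvPolynomial (Fin 3) ℂ →ₐ[ℂ] L)
    (h : τ C₃ ≠ 0) (P : MvPolynomial (Fin 2) ℂ) :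
    aeval ![τ C₁ / τ C₃, τ C₂ / τ C₃] P * τ C₃ ^ P.totalDegree = τ (homogEval C₁ C₂ C₃ P) := by
  rw [homogEval, map_sum, aeval_def, eval₂_eq', Finset.sum_mul]
  refine Finset.sum_congr rfl fun m hm => ?_
  have h1 := add_le_totalDegree hm
  conv_lhs => rw [← Nat.add_sub_cancel' h1]
  simp only [Fin.prod_univ_two, map_mul, map_pow, ← algebraMap_eq, AlgHom.commutes]
  simp only [Matrix.cons_val_zero, Matrix.cons_val_one, div_pow, pow_add]
  field_simp

/-- Restriction to a transverse affine line is injective on forms killed by `jac C₁ C₃`, in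
particular on homogenized relations. The quotients therefore satisfy the same relations as their
restrictions, which are rational functions of one variable. -/
lemma exists_ratFunc_of_jac_eq_zero (hd : 0 < d) (h₁ : C₁.IsHomogeneous d)
    (h₂ : C₂.IsHomogeneous d) (h₃ : C₃.IsHomogeneous d) (h0 : C₃ ≠ 0)
    (hcop : IsRelPrime C₁ C₃) (hJ : jac C₁ C₃ C₂ = 0) {K : Type*} [Field K]
    [Algebra (MvPolynomial (Fin 3) ℂ) K] [IsFractionRing (MvPolynomial (Fin 3) ℂ) K]
    [Algebra ℂ K] [IsScalarTower ℂ (MvPolynomial (Fin 3) ℂ) K] :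
    ∃ h : K, ∃ P₁ Q₁ P₂ Q₂ : Polynomial ℂ,
      algebraMap _ K C₁ / algebraMap _ K C₃ = Polynomial.aeval h P₁ / Polynomial.aeval h Q₁ ∧
      algebraMap _ K C₂ / algebraMap _ K C₃ = Polynomial.aeval h P₂ / Polynomial.aeval h Q₂ := by
  obtain ⟨j, p, hW⟩ := exists_eval_wronskian_ne_zero hd h₃ h0 hcop
  let σ : MvPolynomial (Fin 3) ℂ →ₐ[ℂ] Polynomial ℂ :=
    aeval fun i => Polynomial.C (p i) + Polynomial.X * Polynomial.C ((Pi.single j 1 : Fin 3 → ℂ) i)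
  have hσ : ∀ H t, (σ H).eval t = eval (p + t • Pi.single j 1) H := fun H t => by
    have : (Polynomial.evalRingHom t).comp σ.toRingHom = eval (p + t • Pi.single j 1) := by
      refine MvPolynomial.ringHom_ext (fun r => ?_) fun i => ?_
      · simp
      · simp [σ, mul_comm t]
    exact congrArg (fun f => f H) this
  let φ : MvPolynomial (Fin 3) ℂ →ₐ[ℂ] RatFunc ℂ :=
    (IsScalarTower.toAlgHom ℂ (Polynomial ℂ) (RatFunc ℂ)).comp σ
  have hφ : ∀ {e : ℕ} {ρ : MvPolynomial (Fin 3) ℂ}, ρ.IsHomogeneous e → jac C₁ C₃ ρ = 0 →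
      φ ρ = 0 → ρ = 0 := fun hρ hD h => by
    have hs : σ _ = 0 := (IsFractionRing.to_map_eq_zero_iff (K := RatFunc ℂ)).1 h
    exact eq_zero_of_eval_line_eq_zero hd h₁ h₃ hW hρ hD fun t => by rw [← hσ, hs]; simp
  have hφ₃ : φ C₃ ≠ 0 := fun h => h0 (hφ h₃ (jac_self_right _ _) h)
  let τ : MvPolynomial (Fin 3) ℂ →ₐ[ℂ] K := IsScalarTower.toAlgHom ℂ _ K
  have hτ : ∀ H, τ H = 0 ↔ H = 0 := fun H => IsFractionRing.to_map_eq_zero_iff (K := K)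
  have hτ₃ : τ C₃ ≠ 0 := fun h => h0 ((hτ _).1 h)
  obtain ⟨h, hh⟩ := exists_aeval_div_aeval_of_ker_eq
    (aeval ![φ C₁ / φ C₃, φ C₂ / φ C₃] : MvPolynomial (Fin 2) ℂ →ₐ[ℂ] RatFunc ℂ)
    (aeval ![τ C₁ / τ C₃, τ C₂ / τ C₃] : MvPolynomial (Fin 2) ℂ →ₐ[ℂ] K) fun P => by
      have e1 := aeval_div_mul_pow (C₁ := C₁) (C₂ := C₂) φ hφ₃ P
      have e2 := aeval_div_mul_pow (C₁ := C₁) (C₂ := C₂) τ hτ₃ P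
      constructor
      · intro hP
        rw [hP, zero_mul] at e1
        rw [hφ (homogEval_isHomogeneous h₁ h₂ h₃ P) (jac_homogEval hJ P) e1.symm, map_zero] at e2
        exact (mul_eq_zero.1 e2).resolve_right (pow_ne_zero _ hτ₃)
      · intro hP
        rw [hP, zero_mul] at e2
        rw [(hτ _).1 e2.symm, map_zero] at e1
        exact (mul_eq_zero.1 e1).resolve_right (pow_ne_zero _ hφ₃)
  obtain ⟨P₁, Q₁, e₁⟩ := hh (X 0)
  obtain ⟨P₂, Q₂, e₂⟩ := hh (X 1)
  exact ⟨h, P₁, Q₁, P₂, Q₂, by simpa [τ] using e₁, by simpa [τ] using e₂⟩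

end

end CevaPencil

namespace CevaPencil

open MvPolynomial

/-! ### Rational functions of a pencil -/

/-- The product of the members `u - a v` of a pencil over a multiset of parameters. -/
noncomputable def memberProd (u v : MvPolynomial (Fin 3) ℂ) (M : Multiset ℂ) :
    MvPolynomial (Fin 3) ℂ :=
  (M.map fun a => u - C a * v).prod

@[simp] lemma memberProd_zero (u v : MvPolynomial (Fin 3) ℂ) : memberProd u v 0 = 1 := by
  simp [memberProd]

@[simp] lemma memberProd_cons (u v : MvPolynomial (Fin 3) ℂ) (a : ℂ) (M : Multiset ℂ) :
    memberProd u v (a ::ₘ M) = (u - C a * v) * memberProd u v M := by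
  simp [memberProd]

@[simp] lemma memberProd_add (u v : MvPolynomial (Fin 3) ℂ) (M M' : Multiset ℂ) :
    memberProd u v (M + M') = memberProd u v M * memberProd u v M' := by
  simp [memberProd]

@[simp] lemma memberProd_replicate (u v : MvPolynomial (Fin 3) ℂ) (n : ℕ) (a : ℂ) :
    memberProd u v (Multiset.replicate n a) = (u - C a * v) ^ n := by
  simp [memberProd]

lemma dvd_memberProd {u v : MvPolynomial (Fin 3) ℂ} {M : Multiset ℂ} {a : ℂ} (ha : a ∈ M) :
    u - C a * v ∣ memberProd u v M :=
  Multiset.dvd_prod (Multiset.mem_map_of_mem (fun a => u - C a * v) ha)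

lemma exists_mem_of_prime_dvd_memberProd {u v q : MvPolynomial (Fin 3) ℂ} (hq : Prime q)
    {M : Multiset ℂ} (h : q ∣ memberProd u v M) : ∃ a ∈ M, q ∣ u - C a * v := by
  obtain ⟨_, hb, h⟩ := hq.exists_mem_multiset_dvd h
  obtain ⟨a, ha, rfl⟩ := Multiset.mem_map.1 hb
  exact ⟨a, ha, h⟩

lemma dvd_and_dvd_of_dvd_members {u v D : MvPolynomial (Fin 3) ℂ} {a b : ℂ} (hab : a ≠ b)
    (ha : D ∣ u - C a * v) (hb : D ∣ u - C b * v) : D ∣ u ∧ D ∣ v := by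
  have hu : (C (b - a)⁻¹ : MvPolynomial (Fin 3) ℂ) * (C b - C a) = 1 := by
    rw [← C_sub, ← C_mul, inv_mul_cancel₀ (sub_ne_zero.2 hab.symm), C_1]
  have hv : D ∣ v := by
    have := (dvd_sub ha hb).mul_left (C (b - a)⁻¹)
    rwa [show C (b - a)⁻¹ * (u - C a * v - (u - C b * v)) = v by
      linear_combination v * hu] at this
  exact ⟨by simpa using dvd_add ha (hv.mul_left (C a)), hv⟩

lemma members_isRelPrime {u v : MvPolynomial (Fin 3) ℂ} (huv : IsRelPrime u v) {a b : ℂ}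
    (hab : a ≠ b) : IsRelPrime (u - C a * v) (u - C b * v) := fun _ ha hb =>
  huv (dvd_and_dvd_of_dvd_members hab ha hb).1 (dvd_and_dvd_of_dvd_members hab ha hb).2

lemma eval_eq_zero_of_members {u v : MvPolynomial (Fin 3) ℂ} {a b : ℂ} (hab : a ≠ b)
    {x : Fin 3 → ℂ} (ha : eval x (u - C a * v) = 0) (hb : eval x (u - C b * v) = 0) :
    eval x u = 0 ∧ eval x v = 0 := by
  simp only [map_sub, map_mul, eval_C] at ha hb
  have hv : eval x v = 0 := by
    refine (mul_eq_zero.1 (?_ : (b - a) * _ = 0)).resolve_left (sub_ne_zero.2 hab.symm)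
    linear_combination ha - hb
  exact ⟨by simpa [hv] using ha, hv⟩

lemma memberProd_isRelPrime {u v : MvPolynomial (Fin 3) ℂ} (huv : IsRelPrime u v)
    {M M' : Multiset ℂ} (h : Disjoint M M') :
    IsRelPrime (memberProd u v M) (memberProd u v M') := by
  induction M using Multiset.induction with
  | empty => simpa using isRelPrime_one_left
  | cons a M ih =>
    rw [Multiset.disjoint_cons_left] at h
    rw [memberProd_cons]
    refine IsRelPrime.mul_left ?_ (ih h.2)
    have h1 := h.1
    clear h ih
    induction M' using Multiset.induction with
    | empty => simpa using isRelPrime_one_right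
    | cons b M' ih =>
      rw [Multiset.mem_cons, not_or] at h1
      rw [memberProd_cons]
      exact IsRelPrime.mul_right (members_isRelPrime huv h1.1) (ih h1.2)

section

variable {K : Type*} [Field K] [Algebra (MvPolynomial (Fin 3) ℂ) K] [Algebra ℂ K]
  [IsScalarTower ℂ (MvPolynomial (Fin 3) ℂ) K]

/-- Each root a of `P` differs from c, and (h - a) u = (c - a)(u + (c - a)⁻¹ v). The condition at c
keeps the member `v`, which is not of the form u - a v, out of the product. -/
lemma exists_memberProd_of_polynomial {u v : MvPolynomial (Fin 3) ℂ} {h : K} {c : ℂ}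
    (hh : (h - algebraMap ℂ K c) * algebraMap _ K u = algebraMap _ K v) {P : Polynomial ℂ}
    (hP : P.eval c ≠ 0) :
    ∃ (M : Multiset ℂ) (k : ℂ), k ≠ 0 ∧ Polynomial.aeval h P * algebraMap _ K (u ^ M.card) =
      algebraMap _ K (C k * memberProd u v M) := by
  have halg : ∀ a : ℂ, algebraMap ℂ K a = algebraMap _ K (C a : MvPolynomial (Fin 3) ℂ) :=
    fun a => IsScalarTower.algebraMap_apply ℂ (MvPolynomial (Fin 3) ℂ) K a
  have key : ∀ s : Multiset ℂ, (∀ a ∈ s, c ≠ a) → ∃ (M : Multiset ℂ) (k : ℂ), k ≠ 0 ∧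
      Polynomial.aeval h (s.map fun a => Polynomial.X - Polynomial.C a).prod *
        algebraMap _ K (u ^ M.card) = algebraMap _ K (C k * memberProd u v M) := by
    intro s
    induction s using Multiset.induction with
    | empty => exact fun _ => ⟨0, 1, one_ne_zero, by simp⟩
    | cons a s ih =>
      intro hs
      obtain ⟨M, k, hk, e⟩ := ih fun b hb => hs b (Multiset.mem_cons_of_mem hb)
      have hca : c - a ≠ 0 := sub_ne_zero.2 (hs a (Multiset.mem_cons_self a s))
      refine ⟨-(c - a)⁻¹ ::ₘ M, (c - a) * k, mul_ne_zero hca hk, ?_⟩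
      have h1 : (h - algebraMap ℂ K a) * algebraMap _ K u =
          algebraMap _ K (C (c - a) * (u - C (-(c - a)⁻¹) * v)) := by
        have : C (c - a) * (u - C (-(c - a)⁻¹) * v) = C c * u - C a * u + v := by
          have : (C (c - a) * C (c - a)⁻¹ : MvPolynomial (Fin 3) ℂ) = 1 := by
            rw [← C_mul, mul_inv_cancel₀ hca, C_1]
          rw [C_neg]
          linear_combination v * this + u * C_sub (σ := Fin 3) (a := c) (a' := a)
        rw [this, map_add, map_sub, map_mul, map_mul, ← hh, ← halg, ← halg]
        ring
      rw [Multiset.map_cons, Multiset.prod_cons, map_mul, Multiset.card_cons, pow_succ, map_mul,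
        memberProd_cons, C_mul]
      calc _ = (h - algebraMap ℂ K a) * algebraMap _ K u * (Polynomial.aeval h (s.map fun a =>
            Polynomial.X - Polynomial.C a).prod * algebraMap _ K (u ^ M.card)) := by
              simp only [map_sub, Polynomial.aeval_X, Polynomial.aeval_C]; ring
        _ = _ := by rw [h1, e, ← map_mul]; congr 1; ring
  obtain ⟨M, k, hk, e⟩ := key P.roots fun a ha hc => hP (by
    rw [hc]; exact (Polynomial.mem_roots'.1 ha).2)
  have hP0 : P ≠ 0 := by rintro rfl; simp at hP
  refine ⟨M, P.leadingCoeff * k, mul_ne_zero (Polynomial.leadingCoeff_ne_zero.2 hP0) hk, ?_⟩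
  conv_lhs => rw [(IsAlgClosed.splits P).eq_prod_roots]
  rw [map_mul, mul_assoc, e, Polynomial.aeval_C, halg, ← map_mul, C_mul, mul_assoc]

lemma exists_associated_memberProd [IsFractionRing (MvPolynomial (Fin 3) ℂ) K]
    {u v F G : MvPolynomial (Fin 3) ℂ} (hu : u ≠ 0)
    (huv : IsRelPrime u v) {h : K} {c : ℂ}
    (hh : (h - algebraMap ℂ K c) * algebraMap _ K u = algebraMap _ K v) {P Q : Polynomial ℂ}
    (hP : P.eval c ≠ 0) (hQ : Q.eval c ≠ 0) (hF : F ≠ 0) (hG : G ≠ 0) (hFG : IsRelPrime F G)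
    (e : algebraMap _ K F / algebraMap _ K G = Polynomial.aeval h P / Polynomial.aeval h Q) :
    ∃ M M' : Multiset ℂ, Disjoint M M' ∧ M.card = M'.card ∧ Associated F (memberProd u v M) ∧
      Associated G (memberProd u v M') := by
  classical
  have hinj : ∀ x : MvPolynomial (Fin 3) ℂ, algebraMap _ K x = 0 ↔ x = 0 :=
    fun x => IsFractionRing.to_map_eq_zero_iff
  obtain ⟨N, k, hk, eP⟩ := exists_memberProd_of_polynomial hh hP
  obtain ⟨N', k', hk', eQ⟩ := exists_memberProd_of_polynomial hh hQ
  have hG' : algebraMap _ K G ≠ 0 := fun h => hG ((hinj G).1 h)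
  have hF' : algebraMap _ K F ≠ 0 := fun h => hF ((hinj F).1 h)
  have hQ0 : Polynomial.aeval h Q ≠ 0 := by
    intro h0
    rw [h0, div_zero, div_eq_zero_iff] at e
    tauto
  rw [div_eq_div_iff hG' hQ0] at e
  have hunit : ∀ k : ℂ, k ≠ 0 → IsUnit (C k : MvPolynomial (Fin 3) ℂ) := fun k hk =>
    (isUnit_iff_ne_zero.2 hk).map C
  -- The parameter 0 stands for the member `u`. Clearing denominators with powers of `u` gives both
  -- sides the same number of members; common members are cancelled afterwards.
  let T := N + Multiset.replicate N'.card 0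
  let T' := N' + Multiset.replicate N.card 0
  have e1 : F * (C k' * memberProd u v T') = G * (C k * memberProd u v T) := by
    apply IsFractionRing.injective (MvPolynomial (Fin 3) ℂ) K
    simp only [T, T', memberProd_add, memberProd_replicate, C_0, zero_mul, sub_zero]
    have e2 : algebraMap _ K (F * (C k' * memberProd u v N') * u ^ N.card) =
        algebraMap _ K (G * (C k * memberProd u v N) * u ^ N'.card) := by
      rw [map_mul, map_mul, map_mul _ _ (u ^ _), map_mul _ G, ← eP, ← eQ]
      linear_combination algebraMap _ K (u ^ N'.card) * algebraMap _ K (u ^ N.card) * e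
    convert e2 using 2 <;> ring
  have hT : memberProd u v T ≠ 0 := by
    have hP0 : Polynomial.aeval h P ≠ 0 := by
      intro h0
      rw [h0, zero_mul] at e
      exact mul_ne_zero hF' hQ0 e
    have h1 : C k * memberProd u v N ≠ 0 := fun h0 => by
      rw [h0, map_zero] at eP
      exact mul_ne_zero hP0 ((hinj _).not.2 (pow_ne_zero _ hu)) eP
    simpa [T] using And.intro (right_ne_zero_of_mul h1) fun h => absurd h hu
  have hne : memberProd u v (T ∩ T') ≠ 0 := by
    intro h0
    rw [← Multiset.sub_add_inter T T', memberProd_add, h0, mul_zero] at hT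
    exact hT rfl
  have hdis : Disjoint (T - T') (T' - T) := by
    rw [Multiset.disjoint_left]
    intro a h1 h2
    rw [← Multiset.count_pos, Multiset.count_sub] at h1 h2
    omega
  have hcard : (T - T').card = (T' - T).card := by
    have h1 := congrArg Multiset.card (Multiset.sub_add_inter T T')
    have h2 := congrArg Multiset.card (Multiset.sub_add_inter T' T)
    rw [Multiset.inter_comm] at h2
    simp only [Multiset.card_add, T, T', Multiset.card_replicate] at h1 h2 ⊢
    omega
  have e3 : F * (C k' * memberProd u v (T' - T)) = G * (C k * memberProd u v (T - T')) := by
    have f1 : memberProd u v T = memberProd u v (T - T') * memberProd u v (T ∩ T') := by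
      rw [← memberProd_add, Multiset.sub_add_inter]
    have f2 : memberProd u v T' = memberProd u v (T' - T) * memberProd u v (T ∩ T') := by
      rw [← memberProd_add, Multiset.inter_comm, Multiset.sub_add_inter]
    rw [f1, f2] at e1
    apply mul_right_cancel₀ hne
    linear_combination e1
  have hrel := memberProd_isRelPrime huv hdis
  refine ⟨T - T', T' - T, hdis, hcard, associated_of_dvd_dvd ?_ ?_, associated_of_dvd_dvd ?_ ?_⟩
  · have := hFG.dvd_of_dvd_mul_left ⟨_, e3.symm⟩
    rwa [(hunit k hk).dvd_mul_left] at this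
  · have : memberProd u v (T - T') ∣ F * (C k' * memberProd u v (T' - T)) := ⟨G * C k, by
      rw [e3]; ring⟩
    rw [mul_left_comm, (hunit k' hk').dvd_mul_left] at this
    exact hrel.dvd_of_dvd_mul_right this
  · have := hFG.symm.dvd_of_dvd_mul_left ⟨_, e3⟩
    rwa [(hunit k' hk').dvd_mul_left] at this
  · have : memberProd u v (T' - T) ∣ G * (C k * memberProd u v (T - T')) := ⟨F * C k', by
      rw [← e3]; ring⟩
    rw [mul_left_comm, (hunit k hk).dvd_mul_left] at this
    exact hrel.symm.dvd_of_dvd_mul_right this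

end

end CevaPencil

/-! ### Splitting differences of powers, and the pencil behind three classes -/

namespace CevaPencil

open MvPolynomial

lemma not_isUnit_of_eval_eq_zero {D : MvPolynomial (Fin 3) ℂ} {x : Fin 3 → ℂ}
    (h : eval x D = 0) : ¬ IsUnit D := fun hD => by
  simpa [h] using hD.map (eval x)

lemma eval_zero_of_form_dvd {l : Line} {D : MvPolynomial (Fin 3) ℂ} (h : l.form ∣ D) :
    eval 0 D = 0 := by
  obtain ⟨K, rfl⟩ := h
  rw [map_mul, Line.form, eval_linForm, dotProduct_zero, zero_mul]

lemma eval_eq_zero_of_form_dvd {l : Line} {p : P2} (hp : OnLine p l)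
    {D : MvPolynomial (Fin 3) ℂ} (h : l.form ∣ D) : eval p.rep D = 0 :=
  (linForm_dvd_iff l.rep_nonzero).1 h _ ((onLine_iff p l).1 hp)

/-- The cofactor of `A - B` in `A ^ n - B ^ n`. -/
noncomputable def powCofactor (A B : MvPolynomial (Fin 3) ℂ) (n : ℕ) : MvPolynomial (Fin 3) ℂ :=
  ∑ i ∈ Finset.range n, A ^ i * B ^ (n - 1 - i)

lemma powCofactor_mul (A B : MvPolynomial (Fin 3) ℂ) (n : ℕ) :
    (A - B) * powCofactor A B n = A ^ n - B ^ n := by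
  rw [mul_comm]; exact geom_sum₂_mul A B n

/-- Where A = B, the cofactor takes the value n B^(n-1). -/
lemma eval_eq_zero_of_sub_of_powCofactor {A B : MvPolynomial (Fin 3) ℂ} {n : ℕ} (hn : 0 < n)
    {x : Fin 3 → ℂ} (h1 : eval x (A - B) = 0) (h2 : eval x (powCofactor A B n) = 0) :
    eval x A = 0 ∧ eval x B = 0 := by
  rw [map_sub, sub_eq_zero] at h1
  have h3 : ∑ i ∈ Finset.range n, eval x B ^ (n - 1) = 0 := by
    rw [← h2, powCofactor, map_sum]
    refine Finset.sum_congr rfl fun i hi => ?_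
    rw [map_mul, map_pow, map_pow, h1, ← pow_add]
    congr 1
    have := Finset.mem_range.1 hi
    omega
  rw [Finset.sum_const, Finset.card_range, nsmul_eq_mul, mul_eq_zero] at h3
  have hB := eq_zero_of_pow_eq_zero (h3.resolve_left (by exact_mod_cast hn.ne'))
  exact ⟨h1.trans hB, hB⟩

lemma form_dvd_of_sub_of_powCofactor {A B : MvPolynomial (Fin 3) ℂ} {n : ℕ} (hn : 0 < n)
    {l : Line} (h1 : l.form ∣ A - B) (h2 : l.form ∣ powCofactor A B n) :
    l.form ∣ A ∧ l.form ∣ B := by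
  have h := fun x hx => eval_eq_zero_of_sub_of_powCofactor hn
    ((linForm_dvd_iff l.rep_nonzero).1 h1 x hx) ((linForm_dvd_iff l.rep_nonzero).1 h2 x hx)
  exact ⟨(linForm_dvd_iff l.rep_nonzero).2 fun x hx => (h x hx).1,
    (linForm_dvd_iff l.rep_nonzero).2 fun x hx => (h x hx).2⟩

lemma eval_zero_powCofactor {A B : MvPolynomial (Fin 3) ℂ} {n : ℕ} (hn : 2 ≤ n)
    (hA : eval 0 A = 0) (hB : eval 0 B = 0) : eval 0 (powCofactor A B n) = 0 := by
  rw [powCofactor, map_sum]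
  refine Finset.sum_eq_zero fun i hi => ?_
  rw [map_mul, map_pow, map_pow, hA, hB, ← pow_add, zero_pow]
  have := Finset.mem_range.1 hi
  omega

lemma exists_pow_eq_of_associated {A B : MvPolynomial (Fin 3) ℂ} {n : ℕ} (hn : n ≠ 0)
    (h : Associated (A ^ n) B) : ∃ A', B = A' ^ n := by
  obtain ⟨w, rfl⟩ := h
  obtain ⟨c, hc, hw⟩ := isUnit_iff_eq_C_of_isReduced.1 w.isUnit
  obtain ⟨b, rfl⟩ := IsAlgClosed.exists_pow_nat_eq c (Nat.pos_of_ne_zero hn)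
  exact ⟨A * C b, by rw [hw, mul_pow, C_pow]⟩

/-- With n x = p y + 1, the p-th power of A^x is associated to (U^y)^p U. Cancelling (U^y)^p leaves
a p-th power associated to `U`, and the unit is a constant with a p-th root. -/
lemma exists_pow_eq_of_coprime {U A : MvPolynomial (Fin 3) ℂ} {n p : ℕ} (hp : p ≠ 0)
    (hU : U ≠ 0) (hnp : n.Coprime p) (h : Associated (A ^ p) (U ^ n)) : ∃ B, U = B ^ p := by
  by_cases hp1 : p = 1
  · exact ⟨U, by rw [hp1, pow_one]⟩
  obtain ⟨x, -, hx⟩ := Nat.exists_mul_mod_eq_one_of_coprime hnp (by omega)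
  have hxy : n * x = p * (n * x / p) + 1 := by
    conv_lhs => rw [← Nat.div_add_mod (n * x) p, hx]
  set y := n * x / p
  have h1 : Associated ((A ^ x) ^ p) ((U ^ y) ^ p * U) := by
    have := h.pow_pow (n := x)
    rwa [← pow_mul, ← pow_mul, hxy, pow_succ, mul_comm p x, pow_mul, mul_comm p y,
      pow_mul U y] at this
  obtain ⟨B, hB⟩ := (UniqueFactorizationMonoid.pow_dvd_pow_iff_dvd hp).1
    ((Dvd.intro _ rfl).trans h1.symm.dvd)
  rw [hB, mul_pow] at h1
  exact exists_pow_eq_of_associated (A := B) hp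
    (h1.of_mul_left (Associated.refl _) (pow_ne_zero _ (pow_ne_zero _ hU)))

namespace IsLineNet

variable {ι : Type*} {m : Line → ℕ} {S : ι → Finset Line} {X : Set P2}

/-- Divisibility of `A` spreads along chains: a line of `B` cannot meet a line of `A` outside `X`.
-/
lemma form_dvd_left_of_dvd_mul (h : IsLineNet m S X) {i : ι} {A B : MvPolynomial (Fin 3) ℂ}
    (hAB : ∀ l ∈ S i, l.form ∣ A * B)
    (hX : ∀ p : P2, eval p.rep A = 0 → eval p.rep B = 0 → p ∈ X)
    {l : Line} (hl : l ∈ S i) (hA : l.form ∣ A) : ∀ l' ∈ S i, l'.form ∣ A := by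
  refine h.connected i (fun l => l.form ∣ A) (fun a _ b hb p hp hpa hpb ha => ?_) l hl hA
  rcases b.form_prime.dvd_or_dvd (hAB b hb) with hd | hd
  · exact hd
  · exact absurd (hX p (eval_eq_zero_of_form_dvd hpa ha) (eval_eq_zero_of_form_dvd hpb hd)) hp

lemma mem_of_eval_eq_zero (h : IsLineNet m S X) {i j : ι} (hij : i ≠ j) {p : P2}
    (hi : eval p.rep (lineProd m (S i)) = 0) (hj : eval p.rep (lineProd m (S j)) = 0) : p ∈ X := by
  obtain ⟨l, hl, hpl⟩ := exists_onLine_of_eval_lineProd hi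
  obtain ⟨l', hl', hpl'⟩ := exists_onLine_of_eval_lineProd hj
  exact h.inter_mem i j hij l hl l' hl' p hpl hpl'

lemma exists_form_dvd_member (h : IsLineNet m S X) {i : ι} {u v : MvPolynomial (Fin 3) ℂ}
    {M : Multiset ℂ} (hi : Associated (lineProd m (S i)) (memberProd u v M)) :
    ∃ l ∈ S i, ∃ a ∈ M, l.form ∣ u - C a * v := by
  obtain ⟨l, hl⟩ := h.nonempty i
  obtain ⟨a, ha, hd⟩ := exists_mem_of_prime_dvd_memberProd l.form_prime
    ((form_dvd_lineProd hl (h.pos i l hl)).trans hi.dvd)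
  exact ⟨l, hl, a, ha, hd⟩

/-- Distinct members meet only in `X`, so connectedness puts all lines of the class into one member.
Another member in the product would share a line with it, against coprimality of `u` and `v`. -/
lemma eq_replicate_of_associated (h : IsLineNet m S X) {i : ι} {u v : MvPolynomial (Fin 3) ℂ}
    (huv : IsRelPrime u v) (hu0 : eval 0 u = 0) (hv0 : eval 0 v = 0)
    (hX : ∀ p : P2, eval p.rep u = 0 → eval p.rep v = 0 → p ∈ X) {M : Multiset ℂ}
    (hi : Associated (lineProd m (S i)) (memberProd u v M)) :
    ∃ a, (∀ l ∈ S i, l.form ∣ u - C a * v) ∧ M = Multiset.replicate M.card a := by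
  classical
  obtain ⟨l, hl, a, ha, hd⟩ := h.exists_form_dvd_member hi
  have hall : ∀ l ∈ S i, l.form ∣ u - C a * v := by
    refine h.form_dvd_left_of_dvd_mul (B := memberProd u v (M.filter (· ≠ a))) (fun l hl => ?_)
      (fun p hp hp' => ?_) hl hd
    · obtain ⟨b, hb, hd⟩ := exists_mem_of_prime_dvd_memberProd l.form_prime
        ((form_dvd_lineProd hl (h.pos i l hl)).trans hi.dvd)
      by_cases hba : b = a
      · exact (hba ▸ hd).mul_right _
      · exact (hd.trans (dvd_memberProd (Multiset.mem_filter.2 ⟨hb, hba⟩))).mul_left _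
    · rw [memberProd, map_multiset_prod, Multiset.prod_eq_zero_iff, Multiset.map_map,
        Multiset.mem_map] at hp'
      obtain ⟨b, hb, hp'⟩ := hp'
      have := eval_eq_zero_of_members (Multiset.mem_filter.1 hb).2.symm hp hp'
      exact hX p this.1 this.2
  refine ⟨a, hall, Multiset.eq_replicate_card.2 fun b hb => ?_⟩
  by_contra hba
  obtain ⟨l', hl', hd'⟩ := exists_form_dvd_of_dvd_lineProd
    (not_isUnit_of_eval_eq_zero (x := 0) (by rw [map_sub, map_mul, hu0, hv0, mul_zero, sub_zero]))
    ((dvd_memberProd hb).trans hi.symm.dvd)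
  have := dvd_and_dvd_of_dvd_members hba hd' (hall l' hl')
  exact l'.form_prime.not_isUnit (huv this.1 this.2)

/-- A common zero of `u` and `v` lies on lines of both classes, hence in `X`. As `u` and `v` are not
assumed homogeneous, vanishing at the origin serves to show that members are not units. -/
lemma exists_pow_of_memberProd (h : IsLineNet m S X) {i k : ι} (hik : i ≠ k)
    {u v : MvPolynomial (Fin 3) ℂ} (huv : IsRelPrime u v) {M M' : Multiset ℂ}
    (hMM : Disjoint M M') (hcard : M.card = M'.card)
    (hi : Associated (lineProd m (S i)) (memberProd u v M))
    (hk : Associated (lineProd m (S k)) (memberProd u v M')) :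
    eval 0 u = 0 ∧ eval 0 v = 0 ∧ (∀ p : P2, eval p.rep u = 0 → eval p.rep v = 0 → p ∈ X) ∧
      ∃ a b n, a ≠ b ∧ 0 < n ∧ (∀ l ∈ S i, l.form ∣ u - C a * v) ∧
        (∀ l ∈ S k, l.form ∣ u - C b * v) ∧
        Associated (lineProd m (S i)) ((u - C a * v) ^ n) ∧
        Associated (lineProd m (S k)) ((u - C b * v) ^ n) := by
  obtain ⟨l, hl, a, ha, hd⟩ := h.exists_form_dvd_member hi
  obtain ⟨l', hl', b, hb, hd'⟩ := h.exists_form_dvd_member hk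
  have hab : a ≠ b := fun hab => Multiset.disjoint_left.1 hMM ha (hab ▸ hb)
  obtain ⟨hu0, hv0⟩ := eval_eq_zero_of_members hab (eval_zero_of_form_dvd hd)
    (eval_zero_of_form_dvd hd')
  have hX : ∀ p : P2, eval p.rep u = 0 → eval p.rep v = 0 → p ∈ X := fun p hu hv => by
    have key : ∀ {j : ι} {N : Multiset ℂ} {c : ℂ}, c ∈ N →
        Associated (lineProd m (S j)) (memberProd u v N) → eval p.rep (lineProd m (S j)) = 0 :=
      fun hc hN => by
        obtain ⟨Q, hQ⟩ := (dvd_memberProd hc).trans hN.symm.dvd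
        rw [hQ]; simp [hu, hv]
    exact h.mem_of_eval_eq_zero hik (key ha hi) (key hb hk)
  obtain ⟨a', hda, hMa⟩ := h.eq_replicate_of_associated huv hu0 hv0 hX hi
  obtain ⟨b', hdb, hMb⟩ := h.eq_replicate_of_associated huv hu0 hv0 hX hk
  have haa : a = a' := Multiset.eq_of_mem_replicate (hMa ▸ ha)
  have hbb : b = b' := Multiset.eq_of_mem_replicate (hMb ▸ hb)
  refine ⟨hu0, hv0, hX, a', b', M.card, ?_, Multiset.card_pos_iff_exists_mem.2 ⟨a, ha⟩, hda, hdb,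
    ?_, ?_⟩
  · rintro rfl
    exact Multiset.disjoint_left.1 hMM ha (haa ▸ hbb ▸ hb)
  · rwa [hMa, memberProd_replicate] at hi
  · rwa [hMb, memberProd_replicate, ← hcard] at hk

/-- Three classes of a connected line net are, up to a common power, members of a pencil. -/
theorem exists_pencil (h : IsLineNet m S X) {i j k : ι} (hij : i ≠ j) (hik : i ≠ k)
    (hjk : j ≠ k) :
    ∃ (u v : MvPolynomial (Fin 3) ℂ) (a b c : ℂ) (n : ℕ), IsRelPrime u v ∧
      eval 0 u = 0 ∧ eval 0 v = 0 ∧ (∀ p : P2, eval p.rep u = 0 → eval p.rep v = 0 → p ∈ X) ∧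
      a ≠ b ∧ a ≠ c ∧ b ≠ c ∧ 0 < n ∧
      Associated (lineProd m (S i)) ((u - C a * v) ^ n) ∧
      Associated (lineProd m (S j)) ((u - C b * v) ^ n) ∧
      Associated (lineProd m (S k)) ((u - C c * v) ^ n) := by
  let K := FractionRing (MvPolynomial (Fin 3) ℂ)
  have hdeg : ∀ a, (lineProd m (S a)).IsHomogeneous (∑ l ∈ S i, m l) := fun a => by
    rw [h.sum_eq i a]; exact lineProd_isHomogeneous m (S a)
  have hpi := lineProd_isRelPrime (h.disjoint i k hik) (m := m)
  have hpj := lineProd_isRelPrime (h.disjoint j k hjk) (m := m)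
  have hne := fun a => lineProd_ne_zero m (S a)
  obtain ⟨f, P₁, Q₁, P₂, Q₂, e₁, e₂⟩ := exists_ratFunc_of_jac_eq_zero (h.degree_pos i) (hdeg i)
    (hdeg j) (hdeg k) (hne k) hpi (h.jac_eq_zero hij.symm hjk hik) (K := K)
  have hinj : ∀ x : MvPolynomial (Fin 3) ℂ, algebraMap _ K x ≠ 0 ↔ x ≠ 0 :=
    fun x => IsFractionRing.to_map_eq_zero_iff.not
  have hnz : ∀ {F G : MvPolynomial (Fin 3) ℂ} {P Q : Polynomial ℂ}, F ≠ 0 → G ≠ 0 →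
      algebraMap _ K F / algebraMap _ K G = Polynomial.aeval f P / Polynomial.aeval f Q →
      P ≠ 0 ∧ Q ≠ 0 := fun hF hG e => by
    have h1 := div_ne_zero ((hinj _).2 hF) ((hinj _).2 hG)
    constructor
    · rintro rfl; rw [e] at h1; simp at h1
    · rintro rfl; rw [e] at h1; simp at h1
  obtain ⟨hP₁, hQ₁⟩ := hnz (hne i) (hne k) e₁
  obtain ⟨hP₂, hQ₂⟩ := hnz (hne j) (hne k) e₂
  -- A value c avoiding all zeros and poles is moved to infinity; f - c is then written as v / u in
  -- lowest terms.
  obtain ⟨c, hc⟩ := Infinite.exists_notMem_finset (P₁ * Q₁ * (P₂ * Q₂)).roots.toFinset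
  have hc' : (P₁ * Q₁ * (P₂ * Q₂)).eval c ≠ 0 := fun h0 => hc (by
    rw [Multiset.mem_toFinset, Polynomial.mem_roots
      (mul_ne_zero (mul_ne_zero hP₁ hQ₁) (mul_ne_zero hP₂ hQ₂))]
    exact h0)
  simp only [Polynomial.eval_mul, mul_ne_zero_iff] at hc'
  obtain ⟨⟨hc1, hc2⟩, hc3, hc4⟩ := hc'
  set u : MvPolynomial (Fin 3) ℂ := ↑(IsFractionRing.den (MvPolynomial (Fin 3) ℂ) f) with hu
  set v : MvPolynomial (Fin 3) ℂ := IsFractionRing.num _ f - C c * u with hv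
  have hu0 : u ≠ 0 := nonZeroDivisors.ne_zero (IsFractionRing.den (MvPolynomial (Fin 3) ℂ) f).2
  have huv : IsRelPrime u v := fun D hDu hDv =>
    IsFractionRing.num_den_reduced _ f (by
      have := dvd_add hDv (hDu.mul_left (C c))
      rwa [hv, sub_add_cancel] at this) hDu
  have hfuv : (f - algebraMap ℂ K c) * algebraMap _ K u = algebraMap _ K v := by
    have h1 := IsFractionRing.mk'_num_den' (MvPolynomial (Fin 3) ℂ) f
    rw [div_eq_iff ((hinj _).2 hu0)] at h1
    rw [hv, map_sub, h1, map_mul, sub_mul,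
      IsScalarTower.algebraMap_apply ℂ (MvPolynomial (Fin 3) ℂ) K]
    rfl
  obtain ⟨M, M', hMM, hcard, hMi, hMk⟩ := exists_associated_memberProd hu0 huv hfuv hc1 hc2
    (hne i) (hne k) hpi e₁
  obtain ⟨N, N', hNN, hcard', hNj, hNk⟩ := exists_associated_memberProd hu0 huv hfuv hc3 hc4
    (hne j) (hne k) hpj e₂
  obtain ⟨hu0', hv0', hX, a, b, n, hab, hn, hla, hlb, hCi, hCk⟩ :=
    h.exists_pow_of_memberProd hik huv hMM hcard hMi hMk
  obtain ⟨-, -, -, a', b', n', hab', hn', hla', hlb', hCj, hCk'⟩ :=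
    h.exists_pow_of_memberProd hjk huv hNN hcard' hNj hNk
  obtain ⟨l, hl⟩ := h.nonempty k
  -- Both applications describe class `k`. A line of it lies in only one member, and comparing
  -- powers of that member also identifies the exponents.
  have hbb : b = b' := by
    by_contra hbb
    have := dvd_and_dvd_of_dvd_members hbb (hlb l hl) (hlb' l hl)
    exact l.form_prime.not_isUnit (huv this.1 this.2)
  subst hbb
  have hnu : ¬ IsUnit (u - C b * v) :=
    not_isUnit_of_eval_eq_zero (x := 0) (by rw [map_sub, map_mul, hu0', hv0', mul_zero, sub_zero])
  have hb0 : u - C b * v ≠ 0 := by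
    intro h0
    rw [h0, zero_pow hn.ne'] at hCk
    exact hne k (hCk.eq_zero_iff.2 rfl)
  have hnn : n = n' := le_antisymm
    ((pow_dvd_pow_iff hb0 hnu).1 (hCk.symm.trans hCk').dvd)
    ((pow_dvd_pow_iff hb0 hnu).1 (hCk'.symm.trans hCk).dvd)
  subst hnn
  refine ⟨u, v, a, a', b, n, huv, hu0', hv0', hX, ?_, hab, hab', hn, hCi, hCj, hCk⟩
  rintro rfl
  obtain ⟨l', hl'⟩ := h.nonempty i
  have := (form_dvd_lineProd hl' (h.pos i l' hl')).trans (hCi.trans hCj.symm).dvd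
  exact Finset.disjoint_left.1 (h.disjoint i j hij) hl' (mem_of_form_dvd_lineProd this)

end IsLineNet

end CevaPencil

/-! ### Divisibility of multiplicities in multinets -/

namespace CevaPencil

open MvPolynomial

lemma emultiplicity_form_lineProd {m : Line → ℕ} {S : Finset Line} {l : Line} (hl : l ∈ S) :
    emultiplicity l.form (lineProd m S) = m l := by
  classical
  rw [lineProd, ← Finset.mul_prod_erase S _ hl, emultiplicity_mul l.form_prime,
    emultiplicity_pow_self l.form_prime.ne_zero l.form_prime.not_isUnit,
    emultiplicity_eq_zero.2, add_zero]
  intro h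
  exact Finset.notMem_erase l S (mem_of_form_dvd_lineProd (m := m) h)

lemma lineProd_eq_pow {m : Line → ℕ} {S : Finset Line} {p : ℕ} (h : ∀ l ∈ S, p ∣ m l) :
    lineProd m S = lineProd (fun l => m l / p) S ^ p := by
  rw [lineProd, lineProd, ← Finset.prod_pow]
  refine Finset.prod_congr rfl fun l hl => ?_
  rw [← pow_mul, Nat.div_mul_cancel (h l hl)]

/-- If p does not divide some multiplicity of class `k`, it does not divide n. The members of
classes `i` and `j` are then p-th powers, and the member of class `k` splits into nonunit factors
meeting only in `X`. Connectedness puts every line of class `k` into A - B, so a line of the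
cofactor divides both factors and hence also belongs to class `i`. -/
theorem IsLineNet.dvd_of_dvd {ι : Type*} {m : Line → ℕ} {S : ι → Finset Line} {X : Set P2}
    (h : IsLineNet m S X) {i j k : ι} (hij : i ≠ j) (hik : i ≠ k) (hjk : j ≠ k) {p : ℕ}
    (hp : p.Prime) (hi : ∀ l ∈ S i, p ∣ m l) (hj : ∀ l ∈ S j, p ∣ m l) :
    ∀ l ∈ S k, p ∣ m l := by
  intro l₀ hl₀
  by_contra hpl
  obtain ⟨u, v, a, b, c, n, huv, hu0, hv0, hX, hab, hac, hbc, hn, hCi, hCj, hCk⟩ :=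
    h.exists_pencil hij hik hjk
  have hnp : n.Coprime p := by
    rw [Nat.coprime_comm, hp.coprime_iff_not_dvd]
    intro hpn
    have h1 := emultiplicity_form_lineProd (m := m) hl₀
    rw [emultiplicity_eq_of_associated_right hCk, emultiplicity_pow l₀.form_prime] at h1
    have h2 : emultiplicity l₀.form (u - C c * v) ≠ ⊤ := by
      intro ht
      rw [ht, ENat.mul_top (by exact_mod_cast hn.ne')] at h1
      exact ENat.top_ne_natCast _ h1
    obtain ⟨e, he⟩ := ENat.ne_top_iff_exists.1 h2
    rw [← he] at h1
    have h3 : n * e = m l₀ := by exact_mod_cast h1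
    exact hpl (h3 ▸ hpn.mul_right e)
  have hmem : ∀ {s : ι} {t : ℂ}, Associated (lineProd m (S s)) ((u - C t * v) ^ n) →
      u - C t * v ≠ 0 := fun hs h0 => by
    rw [h0, zero_pow hn.ne'] at hs
    exact lineProd_ne_zero m _ (hs.eq_zero_iff.2 rfl)
  have hdvd : ∀ {s : ι} {t : ℂ}, Associated (lineProd m (S s)) ((u - C t * v) ^ n) →
      u - C t * v ∣ lineProd m (S s) := fun hs => (dvd_pow_self _ hn.ne').trans hs.symm.dvd
  rw [lineProd_eq_pow hi] at hCi
  rw [lineProd_eq_pow hj] at hCj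
  obtain ⟨A, hA⟩ := exists_pow_eq_of_coprime hp.ne_zero (by
    rintro h0
    exact hmem (lineProd_eq_pow hi ▸ hCi) h0) hnp hCi
  obtain ⟨B, hB⟩ := exists_pow_eq_of_coprime hp.ne_zero (by
    rintro h0
    exact hmem (lineProd_eq_pow hj ▸ hCj) h0) hnp hCj
  rw [← lineProd_eq_pow hi] at hCi
  rw [← lineProd_eq_pow hj] at hCj
  -- These constants come from (b - a)(u - c v) = (b - c)(u - a v) - (a - c)(u - b v).
  obtain ⟨r, hr⟩ := IsAlgClosed.exists_pow_nat_eq ((b - c) / (b - a)) hp.pos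
  obtain ⟨s, hs⟩ := IsAlgClosed.exists_pow_nat_eq ((a - c) / (b - a)) hp.pos
  have hba : b - a ≠ 0 := sub_ne_zero.2 hab.symm
  have hr0 : r ≠ 0 := by
    rintro rfl
    rw [zero_pow hp.ne_zero] at hr
    exact div_ne_zero (sub_ne_zero.2 hbc) hba hr.symm
  have hs0 : s ≠ 0 := by
    rintro rfl
    rw [zero_pow hp.ne_zero] at hs
    exact div_ne_zero (sub_ne_zero.2 hac) hba hs.symm
  have hprod : (C r * A - C s * B) * powCofactor (C r * A) (C s * B) p = u - C c * v := by
    rw [powCofactor_mul, mul_pow, mul_pow, ← C_pow, ← C_pow, hr, hs, ← hA, ← hB]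
    have e1 : (b - c) / (b - a) - (a - c) / (b - a) = 1 := by field_simp; ring
    have e2 : (b - c) / (b - a) * a - (a - c) / (b - a) * b = c := by field_simp; ring
    have e1' := congrArg (C : ℂ → MvPolynomial (Fin 3) ℂ) e1
    have e2' := congrArg (C : ℂ → MvPolynomial (Fin 3) ℂ) e2
    simp only [C_sub, C_mul, C_1] at e1' e2'
    linear_combination u * e1' - v * e2'
  have hroot : ∀ {x : Fin 3 → ℂ} {t w : ℂ} {D : MvPolynomial (Fin 3) ℂ}, t ≠ 0 →
      u - C w * v = D ^ p → eval x (C t * D) = 0 → eval x (u - C w * v) = 0 :=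
    fun ht hD h0 => by
      rw [map_mul, eval_C] at h0
      rw [hD, map_pow, (mul_eq_zero.1 h0).resolve_left ht, zero_pow hp.ne_zero]
  have hroot0 : ∀ {t w : ℂ} {D : MvPolynomial (Fin 3) ℂ},
      u - C w * v = D ^ p → eval 0 (C t * D) = 0 := fun {t w D} hD => by
    have : eval 0 D ^ p = 0 := by
      rw [← map_pow, ← hD, map_sub, map_mul, hu0, hv0, mul_zero, sub_zero]
    rw [map_mul, eq_zero_of_pow_eq_zero this, mul_zero]
  have hk := hdvd hCk
  rw [← hprod] at hk
  obtain ⟨l, hl, hld⟩ := exists_form_dvd_of_dvd_lineProd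
    (not_isUnit_of_eval_eq_zero (x := 0) (by rw [map_sub, hroot0 hA, hroot0 hB, sub_zero]))
    ((Dvd.intro _ rfl).trans hk)
  obtain ⟨l', hl', hld'⟩ := exists_form_dvd_of_dvd_lineProd
    (not_isUnit_of_eval_eq_zero (eval_zero_powCofactor hp.two_le (hroot0 hA) (hroot0 hB)))
    ((Dvd.intro_left _ rfl).trans hk)
  have hall := h.form_dvd_left_of_dvd_mul (i := k) (fun l hl => by
    rw [hprod]
    exact l.form_prime.dvd_of_dvd_pow
      ((form_dvd_lineProd hl (h.pos k l hl)).trans hCk.dvd)) (fun q h1 h2 => by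
    obtain ⟨h3, h4⟩ := eval_eq_zero_of_sub_of_powCofactor hp.pos h1 h2
    obtain ⟨h5, h6⟩ := eval_eq_zero_of_members hab (hroot hr0 hA h3) (hroot hs0 hB h4)
    exact hX q h5 h6) hl hld
  obtain ⟨h3, -⟩ := form_dvd_of_sub_of_powCofactor hp.pos (hall l' hl') hld'
  have h4 : l'.form ∣ u - C a * v := by
    rw [((isUnit_iff_ne_zero.2 hr0).map (C : ℂ →+* MvPolynomial (Fin 3) ℂ)).dvd_mul_left] at h3
    rw [hA]
    exact dvd_pow h3 hp.ne_zero
  exact Finset.disjoint_left.1 (h.disjoint i k hik)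
    (mem_of_form_dvd_lineProd (h4.trans (hdvd hCi))) hl'

lemma IsMultinet.isLineNet {A : MultiArrangement} {k d : ℕ} {cls : Fin k → Finset Line}
    {X : Set P2} (h : IsMultinet A k d cls X) : IsLineNet A.mult cls X where
  pos i l hl := A.mult_pos l ((h.mem_lines l).2 ⟨i, hl⟩)
  nonempty := h.nonempty
  disjoint := h.disjoint
  sum_eq i j := (h.sum_eq i).trans (h.sum_eq j).symm
  local_sum p hp _ i j := by
    obtain ⟨n, hn⟩ := h.local_sum p hp
    have h1 := (hn i).trans (hn j).symm
    convert h1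
  inter_mem := h.inter_mem
  connected i Q hQ l hl hQl l' hl' := by
    have : ∀ b, Relation.ReflTransGen (fun a b => a ∈ A.lines ∧ b ∈ A.lines ∧ a ≠ b ∧
        ∀ p, OnLine p a → OnLine p b → p ∉ X) l b → b ∈ cls i ∧ Q b := fun b hb => by
      induction hb with
      | refl => exact ⟨hl, hQl⟩
      | tail _ hab ih =>
        obtain ⟨-, hb, hne, hX⟩ := hab
        obtain ⟨p, hpa, hpb⟩ := exists_onLine_onLine hne
        obtain ⟨j, hj⟩ := (h.mem_lines _).1 hb
        -- A chain may run through all lines of the arrangement, but it cannot leave its class,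
        -- since lines of different classes meet in `X`.
        have hij : i = j := by
          by_contra hij
          exact hX p hpa hpb (h.inter_mem i j hij _ ih.1 _ hj p hpa hpb)
        subst hij
        exact ⟨hj, hQ _ ih.1 _ hj p (hX p hpa hpb) hpa hpb ih.2⟩
    exact (this l' (h.chain i l hl l' hl')).2

/-- In a normalized multinet the multiplicity gcds of the classes are pairwise coprime. -/
theorem IsMultinet.coprime_gcd {A : MultiArrangement} {k d : ℕ} {cls : Fin k → Finset Line}
    {X : Set P2} (h : IsMultinet A k d cls X) (hgcd : A.lines.gcd A.mult = 1) {i j : Fin k}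
    (hij : i ≠ j) : Nat.Coprime ((cls i).gcd A.mult) ((cls j).gcd A.mult) := by
  refine Nat.coprime_of_dvd fun p hp hi hj => ?_
  have hi' : ∀ l ∈ cls i, p ∣ A.mult l := fun l hl => hi.trans (Finset.gcd_dvd hl)
  have hj' : ∀ l ∈ cls j, p ∣ A.mult l := fun l hl => hj.trans (Finset.gcd_dvd hl)
  refine hp.one_lt.ne' (Nat.dvd_one.1 (hgcd ▸ Finset.dvd_gcd fun l hl => ?_))
  obtain ⟨s, hs⟩ := (h.mem_lines l).1 hl
  by_cases his : i = s
  · exact hi' l (his ▸ hs)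
  by_cases hjs : j = s
  · exact hj' l (hjs ▸ hs)
  exact h.isLineNet.dvd_of_dvd hij his hjs hp hi' hj' l hs

end CevaPencil

namespace CevaPencil

open MvPolynomial Topology Filter

/-! ### The classical topology of projective space -/

/-- The quotient map onto projective space. -/
noncomputable def toProj (n : ℕ) (v : {v : Fin n → ℂ // v ≠ 0}) : ℙ ℂ (Fin n → ℂ) :=
  Projectivization.mk ℂ v.1 v.2

lemma isOpenQuotientMap_toProj (n : ℕ) : IsOpenQuotientMap (toProj n) where
  surjective q := ⟨⟨q.rep, q.rep_nonzero⟩, q.mk_rep⟩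
  continuous := continuous_quotient_mk' (s := projectivizationSetoid ℂ (Fin n → ℂ))
  isOpenMap := by
    intro U hU
    have hq : IsQuotientMap (toProj n) :=
      isQuotientMap_quotient_mk' (s := projectivizationSetoid ℂ (Fin n → ℂ))
    rw [← hq.isOpen_preimage]
    let g : ℂˣ → {v : Fin n → ℂ // v ≠ 0} → {v : Fin n → ℂ // v ≠ 0} :=
      fun c v => ⟨c • v.1, (smul_ne_zero_iff_ne c).2 v.2⟩
    have hg : ∀ c, Continuous (g c) := fun c =>
      (continuous_subtype_val.const_smul c).subtype_mk _
    have : toProj n ⁻¹' (toProj n '' U) = ⋃ c, g c ⁻¹' U := by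
      ext v
      simp only [Set.mem_preimage, Set.mem_image, Set.mem_iUnion]
      constructor
      · rintro ⟨w, hw, h⟩
        obtain ⟨c, hc⟩ := (Projectivization.mk_eq_mk_iff ℂ _ _ w.2 v.2).1 h
        exact ⟨c, by rwa [show g c v = w from Subtype.ext hc]⟩
      · rintro ⟨c, hc⟩
        exact ⟨g c v, hc, (Projectivization.mk_eq_mk_iff ℂ _ _ (g c v).2 v.2).2 ⟨c, rfl⟩⟩
    rw [this]
    exact isOpen_iUnion fun c => hU.preimage (hg c)

lemma mk_eq_mk_iff_mul_eq_mul {n : ℕ} {v w : Fin n → ℂ} (hv : v ≠ 0) (hw : w ≠ 0) :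
    Projectivization.mk ℂ v hv = Projectivization.mk ℂ w hw ↔ ∀ i j, v i * w j = v j * w i := by
  rw [Projectivization.mk_eq_mk_iff']
  constructor
  · rintro ⟨a, rfl⟩ i j
    simp only [Pi.smul_apply, smul_eq_mul]
    ring
  · intro h
    obtain ⟨j, hj⟩ := Function.ne_iff.1 hw
    rw [Pi.zero_apply] at hj
    refine ⟨v j / w j, ?_⟩
    funext i
    rw [Pi.smul_apply, smul_eq_mul, div_mul_eq_mul_div, div_eq_iff hj, h]

instance (n : ℕ) : T2Space (ℙ ℂ (Fin n → ℂ)) := by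
  rw [t2Space_iff_of_isOpenQuotientMap (isOpenQuotientMap_toProj n)]
  simp only [toProj, mk_eq_mk_iff_mul_eq_mul, Set.ofPred_forall]
  have h1 : ∀ i, Continuous fun x : {v : Fin n → ℂ // v ≠ 0} × {v : Fin n → ℂ // v ≠ 0} =>
      x.1.1 i := fun i => (continuous_apply i).comp (continuous_subtype_val.comp continuous_fst)
  have h2 : ∀ i, Continuous fun x : {v : Fin n → ℂ // v ≠ 0} × {v : Fin n → ℂ // v ≠ 0} =>
      x.2.1 i := fun i => (continuous_apply i).comp (continuous_subtype_val.comp continuous_snd)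
  exact isClosed_iInter fun i => isClosed_iInter fun j =>
    isClosed_eq ((h1 i).mul (h2 j)) ((h1 j).mul (h2 i))

/-- Reduces limits in projective space to limits of homogeneous coordinates with nonzero limit
vector. -/
lemma tendsto_projMk {n : ℕ} {W : Type*} {l : Filter W} {f : W → Fin n → ℂ}
    {θ : W → ℙ ℂ (Fin n → ℂ)} {y : Fin n → ℂ} (hy : y ≠ 0) (hf : Tendsto f l (𝓝 y))
    (hθ : ∀ᶠ w in l, ∀ h : f w ≠ 0, θ w = Projectivization.mk ℂ (f w) h) :
    Tendsto θ l (𝓝 (Projectivization.mk ℂ y hy)) := by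
  classical
  have hne : ∀ᶠ w in l, f w ≠ 0 := hf.eventually_ne hy
  let F : W → {v : Fin n → ℂ // v ≠ 0} := fun w => if h : f w ≠ 0 then ⟨f w, h⟩ else ⟨y, hy⟩
  have hF : Tendsto F l (𝓝 ⟨y, hy⟩) := by
    rw [tendsto_subtype_rng]
    refine hf.congr' (hne.mono fun w hw => ?_)
    simp [F, hw]
  refine (((isOpenQuotientMap_toProj n).continuous.tendsto _).comp hF).congr' ?_
  filter_upwards [hne, hθ] with w hw hw'
  rw [hw' hw]
  simp [F, hw, toProj]

lemma isClosed_onLine (l : Line) : IsClosed {p : P2 | OnLine p l} := by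
  rw [← (isOpenQuotientMap_toProj 3).isQuotientMap.isClosed_preimage]
  have : toProj 3 ⁻¹' {p : P2 | OnLine p l} = {x | l.rep ⬝ᵥ x.1 = 0} := by
    ext x
    exact onLine_mk_left x.2 l
  rw [this]
  refine isClosed_eq ?_ continuous_const
  exact continuous_finsetSum _ fun i _ => continuous_const.mul
    ((continuous_apply i).comp continuous_subtype_val)

/-! ### Lines and points -/

lemma cross_ne_zero_of_mk_ne {x y : Fin 3 → ℂ} (hx : x ≠ 0) (hy : y ≠ 0)
    (h : Projectivization.mk ℂ x hx ≠ Projectivization.mk ℂ y hy) : crossProduct x y ≠ 0 :=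
  (Projectivization.mk_eq_mk_iff_crossProduct_eq_zero hx hy).not.1 h

lemma linForm_cross_dvd {x y w : Fin 3 → ℂ} (hxy : crossProduct x y ≠ 0) (hx : w ⬝ᵥ x = 0)
    (hy : w ⬝ᵥ y = 0) : linForm (crossProduct x y) ∣ linForm w := by
  rw [linForm_dvd_iff hxy]
  intro z hz
  obtain ⟨s, t, rfl⟩ := exists_eq_smul_add_smul hxy hz
  rw [eval_linForm, dotProduct_add, dotProduct_smul, dotProduct_smul, hx, hy, smul_zero, smul_zero,
    add_zero]

lemma mk_eq_of_linForm_dvd {a b : Fin 3 → ℂ} (ha : a ≠ 0) (hb : b ≠ 0)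
    (h : linForm a ∣ linForm b) : Projectivization.mk ℂ b hb = Projectivization.mk ℂ a ha := by
  obtain ⟨c, -, rfl⟩ := exists_smul_of_linForm_dvd ha hb h
  exact (Projectivization.mk_eq_mk_iff' ℂ _ _ hb ha).2 ⟨c, rfl⟩

lemma form_mk_associated {a : Fin 3 → ℂ} (ha : a ≠ 0) :
    Associated (Line.form (Projectivization.mk ℂ a ha)) (linForm a) := by
  obtain ⟨c, hc⟩ := Projectivization.exists_smul_eq_mk_rep ℂ a ha
  rw [Line.form, ← hc]
  have : linForm (c • a) = C (c : ℂ) * linForm a := linForm_smul _ _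
  rw [this]
  exact associated_unit_mul_left _ _ (c.isUnit.map C)

lemma line_eq_of_onLine {p q : P2} (hpq : p ≠ q) {l l' : Line} (h1 : OnLine p l)
    (h2 : OnLine q l) (h3 : OnLine p l') (h4 : OnLine q l') : l = l' := by
  rw [onLine_iff] at h1 h2 h3 h4
  have hx : crossProduct p.rep q.rep ≠ 0 :=
    cross_ne_zero_of_mk_ne p.rep_nonzero q.rep_nonzero (by rwa [p.mk_rep, q.mk_rep])
  rw [← l.mk_rep, ← l'.mk_rep,
    mk_eq_of_linForm_dvd hx l.rep_nonzero (linForm_cross_dvd hx h1 h2),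
    mk_eq_of_linForm_dvd hx l'.rep_nonzero (linForm_cross_dvd hx h3 h4)]

end CevaPencil

namespace CevaPencil

open MvPolynomial Topology Filter

lemma cross_cross_eq_neg_smul {p e a : Fin 3 → ℂ} (hap : a ⬝ᵥ p = 0) :
    crossProduct p (crossProduct e a) = -(e ⬝ᵥ p) • a := by
  rw [cross_cross_eq_smul_sub_smul', dotProduct_comm p a, hap, zero_smul, zero_sub, neg_smul]

/-! ### The local behaviour of completely reducible forms -/

namespace LinearFactorization

variable {F : MvPolynomial (Fin 3) ℂ}

/-- The coefficient vectors of the linear factors. -/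
noncomputable def vec (f : LinearFactorization F) (i : Fin f.q) : Fin 3 → ℂ :=
  (exists_linForm_of_isHomogeneous (f.homogeneous i)).choose

lemma α_eq (f : LinearFactorization F) (i : Fin f.q) : f.α i = linForm (f.vec i) :=
  (exists_linForm_of_isHomogeneous (f.homogeneous i)).choose_spec

lemma vec_ne_zero (f : LinearFactorization F) (i : Fin f.q) : f.vec i ≠ 0 := fun h =>
  f.ne_zero i (by rw [f.α_eq, h]; simp [linForm])

lemma form_ne_zero (f : LinearFactorization F) : F ≠ 0 := by
  rw [f.eq_prod]
  exact mul_ne_zero (C_ne_zero.2 f.c_ne_zero)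
    (Finset.prod_ne_zero_iff.2 fun i _ => pow_ne_zero _ (f.ne_zero i))

lemma linForm_vec_dvd (f : LinearFactorization F) (i : Fin f.q) : linForm (f.vec i) ∣ F := by
  conv_rhs => rw [f.eq_prod]
  refine Dvd.dvd.mul_left ?_ _
  rw [← f.α_eq]
  exact (dvd_pow_self _ (f.m_pos i).ne').trans
    (Finset.dvd_prod_of_mem (fun i => f.α i ^ f.m i) (Finset.mem_univ i))

lemma exists_dvd_of_prime_dvd (f : LinearFactorization F) {q : MvPolynomial (Fin 3) ℂ}
    (hq : Prime q) (h : q ∣ F) :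
    ∃ i, q ∣ linForm (f.vec i) := by
  rw [f.eq_prod, ((isUnit_iff_ne_zero.2 f.c_ne_zero).map
    (C : ℂ →+* MvPolynomial (Fin 3) ℂ)).dvd_mul_left] at h
  obtain ⟨i, -, hi⟩ := (hq.dvd_finsetProd_iff _).1 h
  exact ⟨i, f.α_eq i ▸ hq.dvd_of_dvd_pow hi⟩

lemma exists_form_dvd (f : LinearFactorization F) {D : MvPolynomial (Fin 3) ℂ}
    (hD : ¬ IsUnit D) (h : D ∣ F) :
    ∃ l : Line, l.form ∣ D := by
  obtain ⟨q, hq, hqD⟩ :=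
    WfDvdMonoid.exists_irreducible_factor hD (ne_zero_of_dvd_ne_zero f.form_ne_zero h)
  obtain ⟨i, hi⟩ := f.exists_dvd_of_prime_dvd (UniqueFactorizationMonoid.irreducible_iff_prime.1 hq)
    (hqD.trans h)
  have h1 := hq.associated_of_dvd (linForm_prime (f.vec_ne_zero i)).irreducible hi
  exact ⟨Projectivization.mk ℂ _ (f.vec_ne_zero i),
    ((form_mk_associated _).trans h1.symm).dvd.trans hqD⟩

lemma finite_form_dvd (f : LinearFactorization F) :
    {l : Line | l.form ∣ F}.Finite := by
  refine (Set.finite_range fun i => (Projectivization.mk ℂ _ (f.vec_ne_zero i) : Line)).subset ?_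
  intro l hl
  obtain ⟨i, hi⟩ := f.exists_dvd_of_prime_dvd (Line.form_prime l) hl
  exact ⟨i, (mk_eq_of_linForm_dvd l.rep_nonzero (f.vec_ne_zero i) hi).trans l.mk_rep⟩

open scoped Classical in
/-- The multiplicity of the curve at the point `p`. -/
noncomputable def localMult (f : LinearFactorization F) (p : Fin 3 → ℂ) : ℕ :=
  ∑ i with f.vec i ⬝ᵥ p = 0, f.m i

open scoped Classical in
/-- The form at `x`, with the linear factors through `p` evaluated at the direction of the line
`a` instead. -/
noncomputable def leading (f : LinearFactorization F) (p e x a : Fin 3 → ℂ) : ℂ :=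
  f.c * ∏ i, (if f.vec i ⬝ᵥ p = 0 then f.vec i ⬝ᵥ crossProduct e a else f.vec i ⬝ᵥ x) ^ f.m i

lemma eval_eq_leading (f : LinearFactorization F) {p e x a : Fin 3 → ℂ} {r ε : ℂ}
    (hx : x = r • p + ε • crossProduct e a) :
    eval x F = ε ^ f.localMult p * f.leading p e x a := by
  classical
  have h1 : ∀ i, eval x (f.α i ^ f.m i) = (if f.vec i ⬝ᵥ p = 0 then ε ^ f.m i else 1) *
      (if f.vec i ⬝ᵥ p = 0 then f.vec i ⬝ᵥ crossProduct e a else f.vec i ⬝ᵥ x) ^ f.m i :=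
    fun i => by
      rw [map_pow, f.α_eq, eval_linForm]
      split_ifs with h
      · rw [← mul_pow, hx, dotProduct_add, dotProduct_smul, dotProduct_smul, h]
        simp
      · rw [one_mul]
  conv_lhs => rw [f.eq_prod]
  rw [map_mul, map_prod, eval_C, Finset.prod_congr rfl fun i _ => h1 i, Finset.prod_mul_distrib,
    ← Finset.prod_filter, Finset.prod_pow_eq_pow_sum, leading, localMult]
  ring

/-- A vanishing factor must be one through `p` that also vanishes at `crossProduct e a`. These two
points span the line `a`, as p × (e × a) = -(e · p) a. -/
lemma linForm_dvd_of_leading_eq_zero (f : LinearFactorization F) {p e a : Fin 3 → ℂ}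
    (ha : a ≠ 0) (hap : a ⬝ᵥ p = 0)
    (hep : e ⬝ᵥ p ≠ 0) (h : f.leading p e p a = 0) : linForm a ∣ F := by
  classical
  rw [leading, mul_eq_zero, Finset.prod_eq_zero_iff] at h
  obtain ⟨i, -, hi⟩ := h.resolve_left f.c_ne_zero
  have hi := eq_zero_of_pow_eq_zero hi
  by_cases hip : f.vec i ⬝ᵥ p = 0
  · rw [if_pos hip] at hi
    have hne : crossProduct p (crossProduct e a) ≠ 0 := by
      rw [cross_cross_eq_neg_smul hap]
      exact smul_ne_zero (neg_ne_zero.2 hep) ha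
    have h1 := linForm_cross_dvd hne hip hi
    rw [cross_cross_eq_neg_smul hap, linForm_smul] at h1
    exact (Dvd.intro_left _ rfl).trans (h1.trans (f.linForm_vec_dvd i))
  · rw [if_neg hip] at hi
    exact absurd hi hip

lemma continuous_leading (f : LinearFactorization F) (p e : Fin 3 → ℂ) :
    Continuous fun z : (Fin 3 → ℂ) × (Fin 3 → ℂ) => f.leading p e z.1 z.2 := by
  classical
  unfold leading
  refine continuous_const.mul (continuous_finsetProd _ fun i _ => Continuous.pow ?_ _)
  split_ifs
  · exact continuous_finsetSum _ fun j _ => continuous_const.mul (by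
      fin_cases j <;> simp [cross_apply] <;> fun_prop)
  · exact continuous_finsetSum _ fun j _ => continuous_const.mul (by fun_prop)

lemma continuous_leading_add_smul (f : LinearFactorization F) (p e v a : Fin 3 → ℂ) :
    Continuous fun ε : ℂ => f.leading p e (p + ε • v) a :=
  (f.continuous_leading p e).comp (f := fun ε : ℂ => (p + ε • v, a)) (by fun_prop)

end LinearFactorization

lemma eq_of_pow_mul_eq {f g : ℂ → ℂ} (hf : Continuous f) (hg : Continuous g) (hf0 : f 0 ≠ 0)
    (hg0 : g 0 ≠ 0) {a b : ℕ} (h : ∀ ε, ε ^ a * f ε = ε ^ b * g ε) : a = b := by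
  have key : ∀ {f g : ℂ → ℂ}, Continuous f → Continuous g → f 0 ≠ 0 → ∀ {a b : ℕ},
      (∀ ε, ε ^ a * f ε = ε ^ b * g ε) → b ≤ a := fun {f g} hf hg hf0 a b h => by
    by_contra! hab
    obtain ⟨c, rfl⟩ := Nat.exists_eq_add_of_lt hab
    have h1 : Set.EqOn f (fun ε => ε ^ (c + 1) * g ε) {0}ᶜ := fun ε hε => by
      apply mul_left_cancel₀ (pow_ne_zero a hε)
      rw [h]; ring
    have := h1.closure hf (by fun_prop)
    rw [(dense_compl_singleton (0 : ℂ)).closure_eq] at this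
    exact hf0 (by simpa using this (Set.mem_univ 0))
  exact le_antisymm (key hg hf hg0 fun ε => (h ε).symm) (key hf hg hf0 h)

/-- On the line `a` the two forms are proportional, so they have the same order of vanishing at `p`.
This order is the local multiplicity because `a` divides neither form. -/
lemma localMult_eq {G H : MvPolynomial (Fin 3) ℂ} (g : LinearFactorization G)
    (h : LinearFactorization H) {p a : Fin 3 → ℂ} (ha : a ≠ 0) (hp : p ≠ 0) (hap : a ⬝ᵥ p = 0)
    {μ ν : ℂ} (hμ : μ ≠ 0) (hν : ν ≠ 0) (hdvd : linForm a ∣ C μ * G + C ν * H)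
    (hG : ¬ linForm a ∣ G) (hH : ¬ linForm a ∣ H) : g.localMult p = h.localMult p := by
  obtain ⟨i, hi⟩ := Function.ne_iff.1 hp
  let e : Fin 3 → ℂ := Pi.single i 1
  have he : e ⬝ᵥ p ≠ 0 := by simpa [e] using hi
  have hx : ∀ ε : ℂ, p + ε • crossProduct e a = (1 : ℂ) • p + ε • crossProduct e a := fun ε => by
    rw [one_smul]
  refine eq_of_pow_mul_eq (f := fun ε => μ * g.leading p e (p + ε • crossProduct e a) a)
    (g := fun ε => -ν * h.leading p e (p + ε • crossProduct e a) a)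
    (continuous_const.mul (g.continuous_leading_add_smul _ _ _ _))
    (continuous_const.mul (h.continuous_leading_add_smul _ _ _ _)) ?_ ?_ fun ε => ?_
  · simp only [zero_smul, add_zero]
    exact mul_ne_zero hμ fun h0 => hG (g.linForm_dvd_of_leading_eq_zero ha hap he h0)
  · simp only [zero_smul, add_zero]
    exact mul_ne_zero (neg_ne_zero.2 hν) fun h0 =>
      hH (h.linForm_dvd_of_leading_eq_zero ha hap he h0)
  · have h1 := (linForm_dvd_iff ha).1 hdvd (p + ε • crossProduct e a) (by
      rw [dotProduct_add, dotProduct_smul, hap, dot_cross_self, smul_zero, add_zero])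
    rw [map_add, map_mul, map_mul, eval_C, eval_C, g.eval_eq_leading (hx ε),
      h.eval_eq_leading (hx ε)] at h1
    linear_combination h1

end CevaPencil

/-! ### Fibers of a pencil, the rational map and the blow-up -/

namespace CevaPencil

open MvPolynomial Topology Filter

/-- The determinant of two representatives of points of the projective line. -/
noncomputable def pairDet (s t : P1) : ℂ := s.rep 0 * t.rep 1 - s.rep 1 * t.rep 0

lemma pairDet_ne_zero {s t : P1} (h : s ≠ t) : pairDet s t ≠ 0 := by
  intro h0
  apply h
  rw [← s.mk_rep, ← t.mk_rep, mk_eq_mk_iff_mul_eq_mul]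
  have h0 := sub_eq_zero.1 h0
  intro i j
  fin_cases i <;> fin_cases j <;> first | rfl | exact h0 | exact h0.symm

namespace Pencil

variable (P : Pencil)

lemma pairDet_mul_fiber (s t u : P1) : C (pairDet t u) * P.fiber s + C (pairDet u s) * P.fiber t +
    C (pairDet s t) * P.fiber u = 0 := by
  simp only [pairDet, fiber, C_sub, C_mul]
  ring

lemma pairDet_mul_C₁ (s t : P1) :
    C (pairDet s t) * P.C₁ = C (t.rep 1) * P.fiber s - C (s.rep 1) * P.fiber t := by
  simp only [pairDet, fiber, C_sub, C_mul]
  ring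

lemma pairDet_mul_C₂ (s t : P1) :
    C (pairDet s t) * P.C₂ = C (s.rep 0) * P.fiber t - C (t.rep 0) * P.fiber s := by
  simp only [pairDet, fiber, C_sub, C_mul]
  ring

lemma fiber_isHomogeneous (s : P1) : (P.fiber s).IsHomogeneous P.d := by
  have h1 := (isHomogeneous_C (Fin 3) (s.rep 0)).mul P.homogeneous₁
  have h2 := (isHomogeneous_C (Fin 3) (s.rep 1)).mul P.homogeneous₂
  rw [zero_add] at h1 h2
  exact h1.add h2

lemma d_pos : 0 < P.d := by
  rw [Nat.pos_iff_ne_zero]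
  intro h0
  have h : ∀ {F : MvPolynomial (Fin 3) ℂ}, F.IsHomogeneous P.d → F = C (coeff 0 F) := fun hF => by
    rw [← totalDegree_eq_zero_iff_eq_C]
    have := hF.totalDegree_le
    omega
  have h1 := h P.homogeneous₁
  have h2 := h P.homogeneous₂
  set a := coeff 0 P.C₁
  set b := coeff 0 P.C₂
  have hli := LinearIndependent.pair_iff.1 P.linearIndependent
  obtain ⟨-, ha⟩ := hli b (-a) (by
    rw [h1, h2, smul_eq_C_mul, smul_eq_C_mul, C_neg]; ring)
  have := P.linearIndependent.ne_zero 0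
  apply this
  change P.C₁ = 0
  rw [h1, neg_eq_zero.1 ha, C_0]

lemma isUnit_of_dvd_fiber {s t : P1} (h : s ≠ t) {D : MvPolynomial (Fin 3) ℂ}
    (hs : D ∣ P.fiber s) (ht : D ∣ P.fiber t) : IsUnit D := by
  have hu := (isUnit_iff_ne_zero.2 (pairDet_ne_zero h)).map (C : ℂ →+* MvPolynomial (Fin 3) ℂ)
  refine P.no_fixed_component ?_ ?_
  · rw [← hu.dvd_mul_left, pairDet_mul_C₁]
    exact dvd_sub (hs.mul_left _) (ht.mul_left _)
  · rw [← hu.dvd_mul_left, pairDet_mul_C₂]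
    exact dvd_sub (ht.mul_left _) (hs.mul_left _)

lemma mem_base_mk {x : Fin 3 → ℂ} (hx : x ≠ 0) :
    Projectivization.mk ℂ x hx ∈ P.base ↔ eval x P.C₁ = 0 ∧ eval x P.C₂ = 0 := by
  obtain ⟨c, hc⟩ := Projectivization.exists_smul_eq_mk_rep ℂ x hx
  change eval (Projectivization.mk ℂ x hx).rep P.C₁ = 0 ∧
    eval (Projectivization.mk ℂ x hx).rep P.C₂ = 0 ↔ _
  rw [← hc]
  change eval ((c : ℂ) • x) P.C₁ = 0 ∧ eval ((c : ℂ) • x) P.C₂ = 0 ↔ _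
  rw [eval_smul_of_isHomogeneous P.homogeneous₁, eval_smul_of_isHomogeneous P.homogeneous₂]
  simp

lemma mem_base_of_fiber {s t : P1} (h : s ≠ t) {x : Fin 3 → ℂ} (hx : x ≠ 0)
    (hs : eval x (P.fiber s) = 0) (ht : eval x (P.fiber t) = 0) :
    Projectivization.mk ℂ x hx ∈ P.base := by
  have h1 := congrArg (eval x) (P.pairDet_mul_C₁ s t)
  have h2 := congrArg (eval x) (P.pairDet_mul_C₂ s t)
  simp only [map_mul, map_sub, eval_C, hs, ht, mul_zero, sub_zero, mul_eq_zero,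
    pairDet_ne_zero h, false_or] at h1 h2
  exact (P.mem_base_mk hx).2 ⟨h1, h2⟩

lemma eval_fiber_of_mem_base {x : Fin 3 → ℂ} (hx : x ≠ 0)
    (h : Projectivization.mk ℂ x hx ∈ P.base) (s : P1) : eval x (P.fiber s) = 0 := by
  obtain ⟨h1, h2⟩ := (P.mem_base_mk hx).1 h
  simp [fiber, h1, h2]

lemma ratMap_mk {x : Fin 3 → ℂ} (hx : x ≠ 0) (h : ![eval x P.C₂, -eval x P.C₁] ≠ 0) :
    P.ratMap (Projectivization.mk ℂ x hx) = Projectivization.mk ℂ _ h := by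
  obtain ⟨c, hc⟩ := Projectivization.exists_smul_eq_mk_rep ℂ x hx
  have hrep : ![eval (Projectivization.mk ℂ x hx).rep P.C₂,
      -eval (Projectivization.mk ℂ x hx).rep P.C₁] =
      ((c : ℂ) ^ P.d) • ![eval x P.C₂, -eval x P.C₁] := by
    rw [← hc]
    change ![eval ((c : ℂ) • x) P.C₂, -eval ((c : ℂ) • x) P.C₁] = _
    rw [eval_smul_of_isHomogeneous P.homogeneous₁, eval_smul_of_isHomogeneous P.homogeneous₂]
    simp
  have hne : ![eval (Projectivization.mk ℂ x hx).rep P.C₂,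
      -eval (Projectivization.mk ℂ x hx).rep P.C₁] ≠ 0 := by
    rw [hrep]
    exact smul_ne_zero (pow_ne_zero _ c.ne_zero) h
  rw [ratMap, dif_pos hne]
  exact (Projectivization.mk_eq_mk_iff' ℂ _ _ hne h).2 ⟨_, hrep.symm⟩

lemma coords_ne_zero {x : Fin 3 → ℂ} (hx : x ≠ 0) (h : Projectivization.mk ℂ x hx ∉ P.base) :
    ![eval x P.C₂, -eval x P.C₁] ≠ 0 := by
  intro h0
  refine h ((P.mem_base_mk hx).2 ⟨?_, ?_⟩)
  · simpa using congrFun h0 1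
  · simpa using congrFun h0 0

lemma mk_eq_iff_of_rep {y : Fin 2 → ℂ} (hy : y ≠ 0) (u : P1) :
    Projectivization.mk ℂ y hy = u ↔ u.rep 1 * y 0 - u.rep 0 * y 1 = 0 := by
  conv_lhs => rw [← u.mk_rep]
  rw [mk_eq_mk_iff_mul_eq_mul]
  constructor
  · intro h
    linear_combination h 0 1
  · intro h i j
    fin_cases i <;> fin_cases j
    · rfl
    · change y 0 * u.rep 1 = y 1 * u.rep 0
      linear_combination h
    · change y 1 * u.rep 0 = y 0 * u.rep 1
      linear_combination -h
    · rfl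

lemma ratMap_mk_eq_iff {x : Fin 3 → ℂ} (hx : x ≠ 0) (h : Projectivization.mk ℂ x hx ∉ P.base)
    (u : P1) : P.ratMap (Projectivization.mk ℂ x hx) = u ↔ eval x (P.fiber u) = 0 := by
  rw [P.ratMap_mk hx (P.coords_ne_zero hx h), mk_eq_iff_of_rep]
  simp only [fiber, map_add, map_mul, eval_C]
  simp [add_comm]

/-! ### The blow-up -/

lemma continuous_blowDown : Continuous P.blowDown :=
  continuous_fst.comp (continuous_subtype_val (p := fun s : P2 × (P.base → Line) =>
    ∀ p : P.base, OnLine p.1 (s.2 p) ∧ OnLine s.1 (s.2 p)))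

lemma isInducing_val : IsInducing fun σ : P.BlowUp => σ.1 :=
  ⟨rfl⟩

/-- The line through the base point `p` at a point of the blow-up. -/
def lineAt (p : P.base) (σ : P.BlowUp) : Line := σ.1.2 p

lemma continuous_lineAt (p : P.base) : Continuous (P.lineAt p) :=
  (continuous_apply p).comp (continuous_snd.comp
    (continuous_subtype_val (p := fun s : P2 × (P.base → Line) =>
      ∀ p : P.base, OnLine p.1 (s.2 p) ∧ OnLine s.1 (s.2 p))))

lemma onLine_lineAt (p : P.base) (σ : P.BlowUp) : OnLine p.1 (P.lineAt p σ) := (σ.2 p).1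

lemma blowDown_onLine_lineAt (p : P.base) (σ : P.BlowUp) :
    OnLine (P.blowDown σ) (P.lineAt p σ) := (σ.2 p).2

/-- The strict transform of a line. -/
def strictTransform (l : Line) : Set P.BlowUp :=
  {σ | OnLine (P.blowDown σ) l ∧ ∀ p : P.base, OnLine p.1 l → P.lineAt p σ = l}

lemma isClosed_strictTransform (l : Line) : IsClosed (P.strictTransform l) := by
  have : P.strictTransform l = P.blowDown ⁻¹' {p | OnLine p l} ∩
      ⋂ p : P.base, ⋂ _ : OnLine p.1 l, P.lineAt p ⁻¹' {l} := by
    ext σ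
    simp [strictTransform]
  rw [this]
  exact ((isClosed_onLine l).preimage P.continuous_blowDown).inter
    (isClosed_iInter fun p => isClosed_iInter fun _ =>
      isClosed_singleton.preimage (P.continuous_lineAt p))

lemma lift_eq_of_notMem_base {σ : P.BlowUp} (h : P.blowDown σ ∉ P.base) :
    P.lift σ = P.ratMap (P.blowDown σ) := by
  refine extendFrom_eq (subset_closure h) ?_
  suffices h : Tendsto P.ratMap (𝓝 (P.blowDown σ)) (𝓝 (P.ratMap (P.blowDown σ))) from
    h.comp (P.continuous_blowDown.continuousAt.mono_left nhdsWithin_le_nhds)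
  generalize P.blowDown σ = q at h
  obtain ⟨⟨x, hx⟩, rfl⟩ := (isOpenQuotientMap_toProj 3).surjective q
  change _ ∉ _ at h
  rw [← (isOpenQuotientMap_toProj 3).map_nhds_eq, tendsto_map'_iff]
  have hne := P.coords_ne_zero hx h
  have : P.ratMap (toProj 3 ⟨x, hx⟩) = _ := P.ratMap_mk hx hne
  rw [this]
  refine tendsto_projMk (f := fun y : {v : Fin 3 → ℂ // v ≠ 0} =>
    ![eval y.1 P.C₂, -eval y.1 P.C₁]) hne ?_ (Eventually.of_forall fun y hy => P.ratMap_mk y.2 hy)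
  have hc : Continuous fun y : {v : Fin 3 → ℂ // v ≠ 0} => ![eval y.1 P.C₂, -eval y.1 P.C₁] := by
    refine continuous_pi fun i => ?_
    fin_cases i
    · exact (MvPolynomial.continuous_eval P.C₂).comp continuous_subtype_val
    · exact ((MvPolynomial.continuous_eval P.C₁).comp continuous_subtype_val).neg
  exact hc.tendsto _

end Pencil

end CevaPencil

/-! ### Extension of the rational map over the exceptional curves -/

namespace CevaPencil

open MvPolynomial Topology Filter

lemma exists_eq_smul_add_smul_cross {p e a x : Fin 3 → ℂ} (ha : a ≠ 0) (hep : e ⬝ᵥ p ≠ 0)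
    (hap : a ⬝ᵥ p = 0) (hax : a ⬝ᵥ x = 0) : ∃ r ε : ℂ, x = r • p + ε • crossProduct e a := by
  apply exists_eq_smul_add_smul
  · rw [cross_cross_eq_neg_smul hap]
    exact smul_ne_zero (neg_ne_zero.2 hep) ha
  · rw [cross_cross_eq_neg_smul hap, smul_dotProduct, hax, smul_zero]

lemma add_smul_cross_ne_zero {p e a : Fin 3 → ℂ} (ha : a ≠ 0) (hep : e ⬝ᵥ p ≠ 0)
    (hap : a ⬝ᵥ p = 0) (ε : ℂ) : p + ε • crossProduct e a ≠ 0 := by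
  intro h
  have h1 := congrArg (fun y => crossProduct y (crossProduct e a)) h
  simp only [map_add, map_smul, LinearMap.add_apply, LinearMap.smul_apply, cross_self, smul_zero,
    add_zero, map_zero, LinearMap.zero_apply] at h1
  rw [cross_cross_eq_neg_smul hap] at h1
  exact smul_ne_zero (neg_ne_zero.2 hep) ha h1

lemma exists_dotProduct_ne_zero {p : Fin 3 → ℂ} (hp : p ≠ 0) : ∃ e : Fin 3 → ℂ, e ⬝ᵥ p ≠ 0 := by
  obtain ⟨i, hi⟩ := Function.ne_iff.1 hp
  exact ⟨Pi.single i 1, by simpa using hi⟩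

lemma LinearFactorization.exists_vec_dotProduct_eq_zero {F : MvPolynomial (Fin 3) ℂ}
    (f : LinearFactorization F) {p : Fin 3 → ℂ} (h : eval p F = 0) : ∃ i, f.vec i ⬝ᵥ p = 0 := by
  rw [f.eq_prod, map_mul, eval_C, map_prod, mul_eq_zero, Finset.prod_eq_zero_iff] at h
  obtain ⟨i, -, hi⟩ := h.resolve_left f.c_ne_zero
  rw [map_pow, f.α_eq, eval_linForm] at hi
  exact ⟨i, eq_zero_of_pow_eq_zero hi⟩

/-- Openness of the projection: nearby points have representatives near the given ones, though `rep`
itself need not be continuous. -/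
lemma eventually_exists_rep {x₀ a₀ : Fin 3 → ℂ} (hx₀ : x₀ ≠ 0) (ha₀ : a₀ ≠ 0)
    {U : Set ((Fin 3 → ℂ) × (Fin 3 → ℂ))} (hU : U ∈ 𝓝 (x₀, a₀)) :
    ∀ᶠ z : P2 × Line in 𝓝 (Projectivization.mk ℂ x₀ hx₀, Projectivization.mk ℂ a₀ ha₀),
      ∃ (x a : Fin 3 → ℂ) (hx : x ≠ 0) (ha : a ≠ 0), (x, a) ∈ U ∧
        Projectivization.mk ℂ x hx = z.1 ∧ Projectivization.mk ℂ a ha = z.2 := by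
  let V := {v : Fin 3 → ℂ // v ≠ 0}
  have hc : Continuous fun z : V × V => (z.1.1, z.2.1) :=
    (continuous_subtype_val.comp continuous_fst).prodMk (continuous_subtype_val.comp continuous_snd)
  have h1 := hc.continuousAt (x := (⟨x₀, hx₀⟩, ⟨a₀, ha₀⟩)) hU
  have h2 := ((isOpenQuotientMap_toProj 3).prodMap
    (isOpenQuotientMap_toProj 3)).isOpenMap.image_mem_nhds h1
  filter_upwards [h2]
  rintro z ⟨y, hy, rfl⟩
  exact ⟨y.1.1, y.2.1, y.1.2, y.2.2, hy, rfl, rfl⟩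

namespace Pencil

variable (P : Pencil)

lemma not_linForm_dvd_of_ne {s t : P1} (h : s ≠ t) {a : Fin 3 → ℂ} (ha : a ≠ 0)
    (hs : linForm a ∣ P.fiber s) : ¬ linForm a ∣ P.fiber t := fun ht =>
  (linForm_prime ha).not_isUnit (P.isUnit_of_dvd_fiber h hs ht)

variable {s t u : P1}

/-- The comparison is made along a line of the third fiber through `p`, on which the other two are
proportional. -/
lemma localMult_fiber_eq (hsu : s ≠ u) (htu : t ≠ u)
    (f : LinearFactorization (P.fiber s)) (g : LinearFactorization (P.fiber t))
    (k : LinearFactorization (P.fiber u)) {p : Fin 3 → ℂ} (hp : p ≠ 0)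
    (hu : eval p (P.fiber u) = 0) : f.localMult p = g.localMult p := by
  obtain ⟨i, hi⟩ := k.exists_vec_dotProduct_eq_zero hu
  refine localMult_eq f g (k.vec_ne_zero i) hp hi (pairDet_ne_zero htu) (pairDet_ne_zero hsu.symm)
    ?_ (P.not_linForm_dvd_of_ne hsu.symm (k.vec_ne_zero i) (k.linForm_vec_dvd i))
    (P.not_linForm_dvd_of_ne htu.symm (k.vec_ne_zero i) (k.linForm_vec_dvd i))
  rw [eq_neg_of_add_eq_zero_left (P.pairDet_mul_fiber s t u)]
  exact ((k.linForm_vec_dvd i).mul_left _).neg_right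

/-- The leading terms of the coordinates of the rational map near a base point `p`. -/
noncomputable def leadingMap (f : LinearFactorization (P.fiber s))
    (g : LinearFactorization (P.fiber t)) (p e x a : Fin 3 → ℂ) : Fin 2 → ℂ :=
  ![s.rep 0 * g.leading p e x a - t.rep 0 * f.leading p e x a,
    s.rep 1 * g.leading p e x a - t.rep 1 * f.leading p e x a]

lemma continuous_leadingMap (f : LinearFactorization (P.fiber s))
    (g : LinearFactorization (P.fiber t)) (p e : Fin 3 → ℂ) :
    Continuous fun z : (Fin 3 → ℂ) × (Fin 3 → ℂ) => P.leadingMap f g p e z.1 z.2 := by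
  have hf := f.continuous_leading p e
  have hg := g.continuous_leading p e
  refine continuous_pi fun i => ?_
  fin_cases i
  · exact (continuous_const.mul hg).sub (continuous_const.mul hf)
  · exact (continuous_const.mul hg).sub (continuous_const.mul hf)

lemma leading_ne_zero (hst : s ≠ t) (f : LinearFactorization (P.fiber s))
    (g : LinearFactorization (P.fiber t)) {p e a : Fin 3 → ℂ} (ha : a ≠ 0) (hap : a ⬝ᵥ p = 0)
    (hep : e ⬝ᵥ p ≠ 0) : ¬ (f.leading p e p a = 0 ∧ g.leading p e p a = 0) := fun h =>
  P.not_linForm_dvd_of_ne hst ha (f.linForm_dvd_of_leading_eq_zero ha hap hep h.1)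
    (g.linForm_dvd_of_leading_eq_zero ha hap hep h.2)

lemma leadingMap_ne_zero (hst : s ≠ t) (f : LinearFactorization (P.fiber s))
    (g : LinearFactorization (P.fiber t)) {p e a : Fin 3 → ℂ} (ha : a ≠ 0) (hap : a ⬝ᵥ p = 0)
    (hep : e ⬝ᵥ p ≠ 0) : P.leadingMap f g p e p a ≠ 0 := by
  intro h
  have h0 : s.rep 0 * g.leading p e p a - t.rep 0 * f.leading p e p a = 0 := congrFun h 0
  have h1 : s.rep 1 * g.leading p e p a - t.rep 1 * f.leading p e p a = 0 := congrFun h 1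
  refine P.leading_ne_zero hst f g ha hap hep ⟨?_, ?_⟩
  · refine (mul_eq_zero.1 (?_ : pairDet s t * _ = 0)).resolve_left (pairDet_ne_zero hst)
    rw [pairDet]
    linear_combination s.rep 1 * h0 - s.rep 0 * h1
  · refine (mul_eq_zero.1 (?_ : pairDet s t * _ = 0)).resolve_left (pairDet_ne_zero hst)
    rw [pairDet]
    linear_combination t.rep 1 * h0 - t.rep 0 * h1

lemma pairDet_smul_coords (f : LinearFactorization (P.fiber s))
    (g : LinearFactorization (P.fiber t)) {p e x a : Fin 3 → ℂ} {r ε : ℂ}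
    (hx : x = r • p + ε • crossProduct e a) (hfg : f.localMult p = g.localMult p) :
    pairDet s t • ![eval x P.C₂, -eval x P.C₁] =
      ε ^ f.localMult p • P.leadingMap f g p e x a := by
  have h1 := congrArg (eval x) (P.pairDet_mul_C₁ s t)
  have h2 := congrArg (eval x) (P.pairDet_mul_C₂ s t)
  simp only [map_mul, map_sub, eval_C, f.eval_eq_leading hx, g.eval_eq_leading hx, ← hfg]
    at h1 h2
  funext i
  fin_cases i
  · simp [leadingMap]
    linear_combination h2
  · simp [leadingMap]
    linear_combination -h1

/-- Near the exceptional curve both coordinates carry the same factor, a power of ε, because the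
local multiplicities agree. Projectively it drops out and leaves the continuous, nonvanishing
leading terms. -/
lemma tendsto_ratMap_blowDown (hst : s ≠ t) (f : LinearFactorization (P.fiber s))
    (g : LinearFactorization (P.fiber t)) {σ : P.BlowUp} (p : P.base) (hσ : P.blowDown σ = p.1)
    (hfg : f.localMult p.1.rep = g.localMult p.1.rep) {e : Fin 3 → ℂ} (hep : e ⬝ᵥ p.1.rep ≠ 0)
    (hne : P.leadingMap f g p.1.rep e p.1.rep (P.lineAt p σ).rep ≠ 0) :
    Tendsto (fun σ => P.ratMap (P.blowDown σ)) (𝓝[{σ | P.blowDown σ ∉ P.base}] σ)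
      (𝓝 (Projectivization.mk ℂ _ hne)) := by
  classical
  let G : (Fin 3 → ℂ) × (Fin 3 → ℂ) → Fin 2 → ℂ := fun z => P.leadingMap f g p.1.rep e z.1 z.2
  obtain ⟨θ, hθG⟩ : ∃ θ : (Fin 3 → ℂ) × (Fin 3 → ℂ) → P1,
      ∀ z (h : G z ≠ 0), θ z = Projectivization.mk ℂ _ h :=
    ⟨fun z => if h : G z ≠ 0 then Projectivization.mk ℂ _ h else Classical.arbitrary P1,
      fun z h => dif_pos h⟩
  have hG : Continuous G := P.continuous_leadingMap f g p.1.rep e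
  have hθ : Tendsto θ (𝓝 (p.1.rep, (P.lineAt p σ).rep)) (𝓝 (Projectivization.mk ℂ _ hne)) :=
    tendsto_projMk (f := G) hne (hG.tendsto _) (Eventually.of_forall hθG)
  intro N hN
  have hG0 : ∀ᶠ z in 𝓝 (p.1.rep, (P.lineAt p σ).rep), G z ≠ 0 :=
    (hG.tendsto (p.1.rep, (P.lineAt p σ).rep)).eventually_ne hne
  have hW : ∀ᶠ z in 𝓝 (p.1.rep, (P.lineAt p σ).rep), G z ≠ 0 ∧ θ z ∈ N :=
    hG0.and (hθ.eventually hN)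
  have himg := eventually_exists_rep p.1.rep_nonzero (P.lineAt p σ).rep_nonzero hW
  rw [p.1.mk_rep, Projectivization.mk_rep, ← hσ] at himg
  have hpre := (P.continuous_blowDown.prodMk (P.continuous_lineAt p)).continuousAt.eventually himg
  rw [mem_map]
  filter_upwards [hpre.filter_mono nhdsWithin_le_nhds, self_mem_nhdsWithin] with σ' h hS
  obtain ⟨x, a, hx, ha, ⟨hz1, hz2⟩, hx', ha'⟩ := h
  have hax : a ⬝ᵥ x = 0 := by
    rw [← onLine_mk hx ha, hx', ha']
    exact P.blowDown_onLine_lineAt p σ'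
  have hap : a ⬝ᵥ p.1.rep = 0 := by
    rw [← onLine_mk p.1.rep_nonzero ha, ha', p.1.mk_rep]
    exact P.onLine_lineAt p σ'
  obtain ⟨r, ε, hxe⟩ := exists_eq_smul_add_smul_cross ha hep hap hax
  change P.blowDown σ' ∉ P.base at hS
  rw [Set.mem_preimage]
  rw [← hx'] at hS ⊢
  rw [hθG _ hz1] at hz2
  rw [P.ratMap_mk hx (P.coords_ne_zero hx hS)]
  have key := P.pairDet_smul_coords f g hxe hfg
  convert hz2 using 1
  rw [Projectivization.mk_eq_mk_iff']
  refine ⟨(pairDet s t)⁻¹ * ε ^ f.localMult p.1.rep, ?_⟩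
  rw [mul_smul]
  change (pairDet s t)⁻¹ • ε ^ f.localMult p.1.rep • P.leadingMap f g p.1.rep e x a = _
  rw [← key, inv_smul_smul₀ (pairDet_ne_zero hst)]

-- Needed because `extendFrom` has a prescribed value only at limit points of the domain. The point
-- `σ` is approached along its own line through `p`.
open scoped Classical in
lemma mem_closure_notMem_base (hst : s ≠ t) (f : LinearFactorization (P.fiber s))
    (g : LinearFactorization (P.fiber t)) {σ : P.BlowUp} (p : P.base)
    (hσ : P.blowDown σ = p.1) : σ ∈ closure {σ | P.blowDown σ ∉ P.base} := by
  set a := (P.lineAt p σ).rep with ha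
  have ha0 : a ≠ 0 := (P.lineAt p σ).rep_nonzero
  have hap : a ⬝ᵥ p.1.rep = 0 := (onLine_iff _ _).1 (P.onLine_lineAt p σ)
  obtain ⟨e, hep⟩ := exists_dotProduct_ne_zero p.1.rep_nonzero
  set v := crossProduct e a with hv
  have hx0 : ∀ ε : ℂ, p.1.rep + ε • v ≠ 0 := add_smul_cross_ne_zero ha0 hep hap
  let q : ℂ → P2 := fun ε => Projectivization.mk ℂ _ (hx0 ε)
  have hq0 : Tendsto q (𝓝[≠] 0) (𝓝 p.1) := by
    have h1 : Tendsto (fun ε : ℂ => p.1.rep + ε • v) (𝓝[≠] 0) (𝓝 p.1.rep) := by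
      have : Continuous fun ε : ℂ => p.1.rep + ε • v := by fun_prop
      simpa using (this.tendsto 0).mono_left nhdsWithin_le_nhds
    rw [← p.1.mk_rep]
    exact tendsto_projMk p.1.rep_nonzero h1 (Eventually.of_forall fun ε h => rfl)
  -- The line at `p` stays fixed; at every other base point the line is the join with the moving
  -- point.
  let w : ℂ → P2 × (P.base → Line) := fun ε =>
    (q ε, fun p' => if p' = p then P.lineAt p σ else Projectivization.cross p'.1 (q ε))
  have hw : Tendsto w (𝓝[≠] 0) (𝓝 σ.1) := by
    have hσ1 : σ.1 = (p.1, σ.1.2) := Prod.ext hσ rfl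
    rw [hσ1]
    refine hq0.prodMk_nhds (tendsto_pi_nhds.2 fun p' => ?_)
    by_cases hpp : p' = p
    · subst hpp
      simp only [if_true]
      exact tendsto_const_nhds
    · simp only [hpp, if_false]
      have hne : p'.1 ≠ p.1 := fun h => hpp (Subtype.ext h)
      have hcr : crossProduct p'.1.rep p.1.rep ≠ 0 :=
        cross_ne_zero_of_mk_ne p'.1.rep_nonzero p.1.rep_nonzero
          (by rwa [p'.1.mk_rep, p.1.mk_rep])
      have hl : σ.1.2 p' = Projectivization.mk ℂ _ hcr := by
        refine line_eq_of_onLine hne (P.onLine_lineAt p' σ)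
          (hσ ▸ P.blowDown_onLine_lineAt p' σ) ?_ ?_
        · conv_lhs => rw [← p'.1.mk_rep]
          rw [onLine_mk, dotProduct_comm, dot_self_cross]
        · conv_lhs => rw [← p.1.mk_rep]
          rw [onLine_mk, dotProduct_comm, dot_cross_self]
      rw [hl]
      refine tendsto_projMk (f := fun ε : ℂ => crossProduct p'.1.rep (p.1.rep + ε • v)) hcr ?_
        (Eventually.of_forall fun ε h => ?_)
      · have : Continuous fun ε : ℂ => crossProduct p'.1.rep (p.1.rep + ε • v) := by
          simp only [map_add, map_smul]
          fun_prop
        simpa using (this.tendsto 0).mono_left nhdsWithin_le_nhds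
      · conv_lhs => rw [← p'.1.mk_rep]
        exact Projectivization.cross_mk_of_cross_ne_zero _ (hx0 ε) h
  have hne : ∀ᶠ ε in 𝓝[≠] (0 : ℂ), q ε ∉ P.base := by
    have hx : ∀ ε : ℂ, p.1.rep + ε • v = (1 : ℂ) • p.1.rep + ε • v := fun ε => by rw [one_smul]
    have key : ∀ {r : P1} (f : LinearFactorization (P.fiber r)),
        f.leading p.1.rep e p.1.rep a ≠ 0 → ∀ᶠ ε in 𝓝[≠] (0 : ℂ), q ε ∉ P.base := by
      intro r f hf
      have hc := (f.continuous_leading_add_smul p.1.rep e v a).tendsto 0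
      simp only [zero_smul, add_zero] at hc
      filter_upwards [(hc.eventually_ne hf).filter_mono nhdsWithin_le_nhds, self_mem_nhdsWithin]
        with ε h1 h2 hb
      have := P.eval_fiber_of_mem_base (hx0 ε) hb r
      rw [f.eval_eq_leading (hx ε)] at this
      exact mul_ne_zero (pow_ne_zero _ h2) h1 this
    by_cases hf : f.leading p.1.rep e p.1.rep a = 0
    · exact key g fun hg => P.leading_ne_zero hst f g ha0 hap hep ⟨hf, hg⟩
    · exact key f hf
  rw [P.isInducing_val.closure_eq_preimage_closure_image]
  refine mem_closure_of_tendsto hw (hne.mono fun ε hε => ?_)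
  have hval : ∀ p' : P.base, OnLine p'.1 ((w ε).2 p') ∧ OnLine (w ε).1 ((w ε).2 p') := by
    intro p'
    by_cases hpp : p' = p
    · subst hpp
      simp only [w, if_true]
      refine ⟨P.onLine_lineAt p' σ, (onLine_mk_left (hx0 ε) _).2 ?_⟩
      rw [dotProduct_add, dotProduct_smul]
      change a ⬝ᵥ _ + ε • (a ⬝ᵥ v) = 0
      rw [hap, hv, dot_cross_self, smul_zero, add_zero]
    · simp only [w, hpp, if_false]
      have hne : p'.1 ≠ q ε := fun h => hε (h ▸ p'.2)
      exact ⟨Projectivization.cross_orthogonal_left hne,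
        Projectivization.cross_orthogonal_right hne⟩
  exact ⟨⟨w ε, hval⟩, hε, rfl⟩

end Pencil

end CevaPencil

/-! ### Connectedness of the lifted fibers and coprimality of exponents -/

namespace CevaPencil

open MvPolynomial Topology Filter

namespace Pencil

variable (P : Pencil) {s t u : P1}

/-- The linear relation between the three fibers passes to their leading terms. The lift takes the
value `u` only where the leading term of the third fiber vanishes, that is, where the direction is
one of its lines. -/
lemma form_lineAt_dvd_of_lift_eq (hst : s ≠ t) (hsu : s ≠ u) (htu : t ≠ u)
    (f : LinearFactorization (P.fiber s)) (g : LinearFactorization (P.fiber t))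
    (k : LinearFactorization (P.fiber u)) {σ : P.BlowUp} (p : P.base)
    (hσ : P.blowDown σ = p.1) (hlift : P.lift σ = u) : (P.lineAt p σ).form ∣ P.fiber u := by
  have hp0 := p.1.rep_nonzero
  have hbase : ∀ r, eval p.1.rep (P.fiber r) = 0 :=
    P.eval_fiber_of_mem_base hp0 (by rw [p.1.mk_rep]; exact p.2)
  have hfg := P.localMult_fiber_eq hsu htu f g k hp0 (hbase u)
  have hgk := P.localMult_fiber_eq hst.symm hsu.symm g k f hp0 (hbase s)
  obtain ⟨e, hep⟩ := exists_dotProduct_ne_zero hp0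
  set a := (P.lineAt p σ).rep
  have ha0 : a ≠ 0 := (P.lineAt p σ).rep_nonzero
  have hap : a ⬝ᵥ p.1.rep = 0 := (onLine_iff _ _).1 (P.onLine_lineAt p σ)
  have hne := P.leadingMap_ne_zero hst f g ha0 hap hep
  have hval : P.lift σ = Projectivization.mk ℂ _ hne :=
    extendFrom_eq (P.mem_closure_notMem_base hst f g p hσ)
      (P.tendsto_ratMap_blowDown hst f g p hσ hfg hep hne)
  rw [hval, mk_eq_iff_of_rep] at hlift
  have hlift' : u.rep 1 * (s.rep 0 * g.leading p.1.rep e p.1.rep a -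
      t.rep 0 * f.leading p.1.rep e p.1.rep a) -
      u.rep 0 * (s.rep 1 * g.leading p.1.rep e p.1.rep a -
      t.rep 1 * f.leading p.1.rep e p.1.rep a) = 0 := hlift
  -- For ε ≠ 0 the common power of ε cancels; the relation extends to ε = 0 by continuity.
  have key : Set.EqOn (fun ε : ℂ =>
      pairDet t u * f.leading p.1.rep e (p.1.rep + ε • crossProduct e a) a +
      pairDet u s * g.leading p.1.rep e (p.1.rep + ε • crossProduct e a) a +
      pairDet s t * k.leading p.1.rep e (p.1.rep + ε • crossProduct e a) a) (fun _ => 0) {0}ᶜ := by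
    intro ε hε
    have hx : p.1.rep + ε • crossProduct e a = (1 : ℂ) • p.1.rep + ε • crossProduct e a := by
      rw [one_smul]
    have h1 := congrArg (eval (p.1.rep + ε • crossProduct e a)) (P.pairDet_mul_fiber s t u)
    simp only [map_add, map_mul, eval_C, map_zero, f.eval_eq_leading hx, g.eval_eq_leading hx,
      k.eval_eq_leading hx, hfg, ← hgk] at h1
    refine (mul_eq_zero.1 (?_ : ε ^ g.localMult p.1.rep * _ = 0)).resolve_left
      (pow_ne_zero _ hε)
    linear_combination h1
  have hcl := key.closure
    (((continuous_const.mul (f.continuous_leading_add_smul _ _ _ _)).add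
      (continuous_const.mul (g.continuous_leading_add_smul _ _ _ _))).add
      (continuous_const.mul (k.continuous_leading_add_smul _ _ _ _))) continuous_const
  rw [(dense_compl_singleton (0 : ℂ)).closure_eq] at hcl
  have h0 := hcl (Set.mem_univ 0)
  simp only [zero_smul, add_zero] at h0
  refine k.linForm_dvd_of_leading_eq_zero ha0 hap hep
    ((mul_eq_zero.1 (?_ : pairDet s t * _ = 0)).resolve_left (pairDet_ne_zero hst))
  simp only [pairDet] at h0 ⊢
  linear_combination h0 + hlift'

lemma mem_strictTransform_of_lift_eq (hst : s ≠ t) (hsu : s ≠ u) (htu : t ≠ u)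
    (f : LinearFactorization (P.fiber s)) (g : LinearFactorization (P.fiber t))
    (k : LinearFactorization (P.fiber u)) {σ : P.BlowUp} (hlift : P.lift σ = u) :
    ∃ l : Line, l.form ∣ P.fiber u ∧ σ ∈ P.strictTransform l := by
  -- Only the line at the image point itself needs checking: at any other base point of `l` both
  -- lines are the join of two distinct points.
  have key : ∀ l : Line, OnLine (P.blowDown σ) l →
      (∀ h : P.blowDown σ ∈ P.base, P.lineAt ⟨_, h⟩ σ = l) → σ ∈ P.strictTransform l := by
    intro l hl hb
    refine ⟨hl, fun p hp => ?_⟩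
    by_cases h : p.1 = P.blowDown σ
    · obtain ⟨p, hp'⟩ := p
      dsimp only at h
      subst h
      exact hb hp'
    · exact line_eq_of_onLine h (P.onLine_lineAt p σ) (P.blowDown_onLine_lineAt p σ) hp hl
  by_cases h : P.blowDown σ ∈ P.base
  · refine ⟨P.lineAt ⟨_, h⟩ σ, P.form_lineAt_dvd_of_lift_eq hst hsu htu f g k ⟨_, h⟩ rfl hlift,
      key _ (P.blowDown_onLine_lineAt _ σ) fun _ => rfl⟩
  · rw [P.lift_eq_of_notMem_base h] at hlift
    have hx := (P.blowDown σ).rep_nonzero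
    have h' : Projectivization.mk ℂ _ hx ∉ P.base := by rwa [Projectivization.mk_rep]
    have h0 : eval (P.blowDown σ).rep (P.fiber u) = 0 := by
      rw [← P.ratMap_mk_eq_iff hx h', Projectivization.mk_rep, hlift]
    obtain ⟨i, hi⟩ := k.exists_vec_dotProduct_eq_zero h0
    refine ⟨Projectivization.mk ℂ _ (k.vec_ne_zero i),
      (form_mk_associated _).dvd.trans (k.linForm_vec_dvd i), key _ ?_ fun hb => absurd hb h⟩
    rw [← (P.blowDown σ).mk_rep, onLine_mk]
    exact hi

-- A point of `l` off the fiber over `s` is not a base point, so the rational map is defined there,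
-- with value `u`.
open scoped Classical in
lemma exists_mem_strictTransform (hsu : s ≠ u) {l : Line} (hl : l.form ∣ P.fiber u) :
    ∃ σ ∈ P.strictTransform l, P.lift σ = u := by
  obtain ⟨x, hlx, hx⟩ : ∃ x, l.rep ⬝ᵥ x = 0 ∧ eval x (P.fiber s) ≠ 0 := by
    by_contra! h
    exact P.not_linForm_dvd_of_ne hsu.symm l.rep_nonzero hl
      ((linForm_dvd_iff l.rep_nonzero).2 h)
  have hx0 : x ≠ 0 := by
    rintro rfl
    have := eval_smul_of_isHomogeneous (P.fiber_isHomogeneous s) 0 0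
    rw [smul_zero, zero_pow P.d_pos.ne', zero_mul] at this
    exact hx this
  set q : P2 := Projectivization.mk ℂ x hx0
  have hq : q ∉ P.base := fun h => hx (P.eval_fiber_of_mem_base hx0 h s)
  have hne : ∀ p : P.base, p.1 ≠ q := fun p h => hq (h ▸ p.2)
  let σ : P.BlowUp := ⟨(q, fun p => Projectivization.cross p.1 q), fun p =>
    ⟨Projectivization.cross_orthogonal_left (hne p),
      Projectivization.cross_orthogonal_right (hne p)⟩⟩
  have hql : OnLine q l := (onLine_mk_left hx0 l).2 hlx
  have hσ : P.blowDown σ = q := rfl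
  refine ⟨σ, ⟨hql, fun p hp => line_eq_of_onLine (hne p) (P.onLine_lineAt p σ)
    (P.blowDown_onLine_lineAt p σ) hp hql⟩, ?_⟩
  rw [P.lift_eq_of_notMem_base (by rwa [hσ]), hσ, P.ratMap_mk_eq_iff hx0 hq]
  exact (linForm_dvd_iff l.rep_nonzero).1 hl x hlx

/-- If a completely reducible fiber of a connected pencil with two further completely reducible
fibers is a product of two nonunits, then these contain lines that meet outside the base or
coincide. -/
lemma exists_common_of_mul_eq_fiber (hP : P.IsConnectedPencil) (hst : s ≠ t) (hsu : s ≠ u)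
    (htu : t ≠ u) (f : LinearFactorization (P.fiber s)) (g : LinearFactorization (P.fiber t))
    (k : LinearFactorization (P.fiber u)) {E D : MvPolynomial (Fin 3) ℂ}
    (hED : E * D = P.fiber u) (hE : ¬ IsUnit E) (hD : ¬ IsUnit D) :
    ∃ l l' : Line, l.form ∣ E ∧ l'.form ∣ D ∧ ∃ q : P2, OnLine q l ∧ OnLine q l' ∧
      (q ∈ P.base → l = l') := by
  have hEu : E ∣ P.fiber u := ⟨D, hED.symm⟩
  have hDu : D ∣ P.fiber u := ⟨E, by rw [← hED, mul_comm]⟩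
  have hclosed : ∀ G, G ∣ P.fiber u →
      IsClosed (⋃ l ∈ {l : Line | l.form ∣ G}, P.strictTransform l) := fun G hG =>
    (k.finite_form_dvd.subset fun l hl => Dvd.dvd.trans hl hG).isClosed_biUnion fun l _ =>
      P.isClosed_strictTransform l
  have hmeet : ∀ G, ¬ IsUnit G → G ∣ P.fiber u → (P.lift ⁻¹' {u} ∩
      ⋃ l ∈ {l : Line | l.form ∣ G}, P.strictTransform l).Nonempty := fun G hG hGu => by
    obtain ⟨l, hl⟩ := k.exists_form_dvd hG hGu
    obtain ⟨σ, hσ, hlift⟩ := P.exists_mem_strictTransform hsu (hl.trans hGu)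
    exact ⟨σ, hlift, Set.mem_biUnion (show l ∈ {l : Line | l.form ∣ G} from hl) hσ⟩
  -- The strict transforms of the lines of `E` and of `D` form two closed sets that cover the
  -- connected fiber and both meet it.
  obtain ⟨σ, -, hσ1, hσ2⟩ := isPreconnected_closed_iff.1 (hP u).isPreconnected _ _ (hclosed E hEu)
    (hclosed D hDu) (fun σ hσ => by
      obtain ⟨l, hl, hlσ⟩ := P.mem_strictTransform_of_lift_eq hst hsu htu f g k hσ
      rw [← hED] at hl
      rcases l.form_prime.dvd_or_dvd hl with h | h
      · exact Or.inl (Set.mem_biUnion (show l ∈ {l : Line | l.form ∣ E} from h) hlσ)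
      · exact Or.inr (Set.mem_biUnion (show l ∈ {l : Line | l.form ∣ D} from h) hlσ))
    (hmeet E hE hEu) (hmeet D hD hDu)
  obtain ⟨l, hl, hlσ⟩ := Set.mem_iUnion₂.1 hσ1
  obtain ⟨l', hl', hlσ'⟩ := Set.mem_iUnion₂.1 hσ2
  exact ⟨l, l', hl, hl', P.blowDown σ, hlσ.1, hlσ'.1, fun hb =>
    (hlσ.2 ⟨_, hb⟩ hlσ.1).symm.trans (hlσ'.2 ⟨_, hb⟩ hlσ'.1)⟩

end Pencil

lemma LinearFactorization.exists_C_mul_eq_pow {F : MvPolynomial (Fin 3) ℂ}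
    (f : LinearFactorization F) {p : ℕ} (hp : 0 < p) (h : ∀ i, p ∣ f.m i) (c : ℂ) :
    ∃ A, C c * F = A ^ p := by
  obtain ⟨r, hr⟩ := IsAlgClosed.exists_pow_nat_eq (c * f.c) hp
  refine ⟨C r * ∏ i, f.α i ^ (f.m i / p), ?_⟩
  conv_lhs => rw [f.eq_prod]
  rw [mul_pow, ← C_pow, hr, C_mul, mul_assoc, ← Finset.prod_pow]
  congr 2
  refine Finset.prod_congr rfl fun i _ => ?_
  rw [← pow_mul, Nat.div_mul_cancel (h i)]

/-- The exponents of two distinct completely reducible fibers of a Ceva pencil are coprime. -/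
theorem Pencil.IsCeva.coprime_exponent {P : Pencil} (hP : P.IsCeva) {s t : P1} (hst : s ≠ t)
    (f : LinearFactorization (P.fiber s)) (g : LinearFactorization (P.fiber t)) :
    Nat.Coprime f.exponent g.exponent := by
  refine Nat.coprime_of_dvd fun p hp hpf hpg => ?_
  have hpf' : ∀ i, p ∣ f.m i := fun i => hpf.trans (Finset.gcd_dvd (Finset.mem_univ i))
  have hpg' : ∀ i, p ∣ g.m i := fun i => hpg.trans (Finset.gcd_dvd (Finset.mem_univ i))
  obtain ⟨hconn, τ, hτ, hred⟩ := hP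
  obtain ⟨u, ⟨k⟩, hsu, htu⟩ : ∃ u, IsCompletelyReducible (P.fiber u) ∧ s ≠ u ∧ t ≠ u := by
    by_contra! h
    have h' : ∀ i, τ i = s ∨ τ i = t := fun i => by
      by_cases hs : s = τ i
      · exact Or.inl hs.symm
      · exact Or.inr (h _ (hred i) hs).symm
    have h01 := hτ.ne (show (0 : Fin 3) ≠ 1 by decide)
    have h02 := hτ.ne (show (0 : Fin 3) ≠ 2 by decide)
    have h12 := hτ.ne (show (1 : Fin 3) ≠ 2 by decide)
    rcases h' 0 with h0 | h0 <;> rcases h' 1 with h1 | h1 <;> rcases h' 2 with h2 | h2 <;>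
      simp_all
  -- The constants solve the relation `pairDet_mul_fiber` for the fiber over `u`, written as a
  -- difference.
  obtain ⟨A, hA⟩ := f.exists_C_mul_eq_pow hp.pos hpf' (-(pairDet s t)⁻¹ * pairDet t u)
  obtain ⟨B, hB⟩ := g.exists_C_mul_eq_pow hp.pos hpg' ((pairDet s t)⁻¹ * pairDet u s)
  have hED : (A - B) * powCofactor A B p = P.fiber u := by
    have h1 : (C (pairDet s t)⁻¹ * C (pairDet s t) : MvPolynomial (Fin 3) ℂ) = 1 := by
      rw [← C_mul, inv_mul_cancel₀ (pairDet_ne_zero hst), C_1]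
    rw [powCofactor_mul, ← hA, ← hB]
    simp only [C_mul, C_neg]
    linear_combination P.fiber u * h1 - C (pairDet s t)⁻¹ * P.pairDet_mul_fiber s t u
  have hz : ∀ r, eval 0 (P.fiber r) = 0 := fun r => by
    have := eval_smul_of_isHomogeneous (P.fiber_isHomogeneous r) 0 0
    rwa [smul_zero, zero_pow P.d_pos.ne', zero_mul] at this
  have hA0 : eval 0 A = 0 := eq_zero_of_pow_eq_zero (n := p) (by
    rw [← map_pow, ← hA, map_mul, hz, mul_zero])
  have hB0 : eval 0 B = 0 := eq_zero_of_pow_eq_zero (n := p) (by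
    rw [← map_pow, ← hB, map_mul, hz, mul_zero])
  obtain ⟨l, l', hl, hl', q, hql, hql', hq⟩ := P.exists_common_of_mul_eq_fiber hconn hst hsu htu
    f g k hED (not_isUnit_of_eval_eq_zero (x := 0) (by rw [map_sub, hA0, hB0, sub_zero]))
    (not_isUnit_of_eval_eq_zero (eval_zero_powCofactor hp.two_le hA0 hB0))
  have hcs : -(pairDet s t)⁻¹ * pairDet t u ≠ 0 :=
    mul_ne_zero (neg_ne_zero.2 (inv_ne_zero (pairDet_ne_zero hst))) (pairDet_ne_zero htu)
  have hct : (pairDet s t)⁻¹ * pairDet u s ≠ 0 :=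
    mul_ne_zero (inv_ne_zero (pairDet_ne_zero hst)) (pairDet_ne_zero hsu.symm)
  have hqb : q ∈ P.base := by
    obtain ⟨h1, h2⟩ := eval_eq_zero_of_sub_of_powCofactor hp.pos (eval_eq_zero_of_form_dvd hql hl)
      (eval_eq_zero_of_form_dvd hql' hl')
    have e1 := congrArg (eval q.rep) hA
    have e2 := congrArg (eval q.rep) hB
    rw [map_mul, map_pow, h1, zero_pow hp.ne_zero, eval_C] at e1
    rw [map_mul, map_pow, h2, zero_pow hp.ne_zero, eval_C] at e2
    rw [← q.mk_rep]
    exact P.mem_base_of_fiber hst q.rep_nonzero ((mul_eq_zero.1 e1).resolve_left hcs)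
      ((mul_eq_zero.1 e2).resolve_left hct)
  -- Over a base point the two lines coincide, so a single line divides both factors, hence both A
  -- and B and the fibers over `s` and `t`.
  obtain rfl := hq hqb
  obtain ⟨h1, h2⟩ := form_dvd_of_sub_of_powCofactor hp.pos hl hl'
  have h1 := h1.trans (dvd_pow_self A hp.ne_zero)
  have h2 := h2.trans (dvd_pow_self B hp.ne_zero)
  rw [← hA, ((isUnit_iff_ne_zero.2 hcs).map (C : ℂ →+* MvPolynomial (Fin 3) ℂ)).dvd_mul_left] at h1
  rw [← hB, ((isUnit_iff_ne_zero.2 hct).map (C : ℂ →+* MvPolynomial (Fin 3) ℂ)).dvd_mul_left] at h2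
  exact l.form_prime.not_isUnit (P.isUnit_of_dvd_fiber hst h1 h2)

end CevaPencil

theorem proposition3p13 :
    (∀ P : CevaPencil.Pencil, P.IsCeva →
      ∀ s t : CevaPencil.P1, s ≠ t →
        ∀ (f : CevaPencil.LinearFactorization (P.fiber s))
          (g : CevaPencil.LinearFactorization (P.fiber t)),
          Nat.Coprime f.exponent g.exponent) ∧
    (∀ (A : CevaPencil.MultiArrangement) (k d : ℕ) (cls : Fin k → Finset CevaPencil.Line)
      (X : Set CevaPencil.P2),
      CevaPencil.IsMultinet A k d cls X →
      A.lines.gcd A.mult = 1 →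
        ∀ i j : Fin k, i ≠ j →
          Nat.Coprime ((cls i).gcd A.mult) ((cls j).gcd A.mult)) :=
  ⟨fun _ hP _ _ hst f g => hP.coprime_exponent hst f g,
    fun _ _ _ _ _ h hgcd _ _ hij => h.coprime_gcd hgcd hij⟩
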